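/- **Theorem (Mode Insertion Gradient).** *Setting.* Let $T\ge 1$ be an integer, $\rho_{\max}<\infty$, $B=\{w\in\mathbb R^m:\|w\|_2\le\rho_{\max}\}$, and let $u:[0,T]\to B$ be piecewise continuous. Let $x_0\in\mathbb R^{n_x}$. For a piecewise continuous control $w:[0,T]\to B$ and observations $y_1,\dots,y_T\in\mathbb R^{n_y}$ consider the hybrid system with modes $x_i$ on $[i-1,i]$, $i=1,\dots,T$, $$x_1(0)=x_0,\qquad \dot x_i(t)=f(x_i(t),w(t)),\qquad x_{i+1}(i)=g(x_i(i),y_i),$$ where the differential equation is understood in integral form, with continuous $x_i$. Put $x(t)=x_i(t)$ for $t\in[i-1,i)$ and $x(T)=g(x_T(T),y_T)$. Assume: * $f:\mathbb R^{n_x}\times\mathbb R^m\to\mathbb R^{n_x}$ is $C^1$, and there is $K_1\in[1,\infty)$ with $\|f(x',u')-f(x'',u'')\|_2\le K_1(\|x'-x''\|_2+\|u'-u''\|_2)$ for all $x',x''\in\mathbb R^{n_x}$ and $u',u''\in B$; * $g:\mathbb R^{n_x}\times\mathbb R^{n_y}\to\mathbb R^{n_x}$ is continuous and differentiable in $x$,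 and there are finite $K_2,\dots,K_5\ge0$ and positive integers $L_1,L_2$ such that $\|g(x,y)\|_2$ and $\|\frac{\partial}{\partial x}g(x,y)\|_2$ are both at most $K_2+K_3\|x\|_2^{L_1}+K_4\|y\|_2^{L_2}+K_5\|x\|_2^{L_1}\|y\|_2^{L_2}$ for all $x,y$; * $c:\mathbb R^{n_x}\times\mathbb R^m\to\mathbb R$ is continuous, and continuously differentiable in $x$; $h:\mathbb R^{n_x}\to\mathbb R$ is differentiable; and there are finite $K_6,K_7\ge0$ and a positive integer $L_3$ such that $|c(x,w)|$, $\|\frac{\partial}{\partial x}c(x,w)\|_2$, $|h(x)|$ and $\|\frac{\partial}{\partial x}h(x)\|_2$ are at most $K_6+K_7\|x\|_2^{L_3}$ for all $x\in\mathbb R^{n_x}$ and $w\in B$; * $Y_1,\dots,Y_T$ are random vectors in $\mathbb R^{n_y}$ on a probability space with $\mathbb E[\|Y_i\|_2^k]<\infty$ for all $i$ and all $k\in\mathbb N$. Fix $\tau\in(0,1)$ such that $u$ is left continuous at $\tau$, and $v\in B$. For $\epsilon\in[0,\tau]$ let $u^\epsilon(t)=v$ for $t\in(\tau-\epsilon,\tau]$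 and $u^\epsilon(t)=u(t)$ otherwise. *Conclusion.* For every $\epsilon\in[0,\tau]$ and all observations the system under $u^\epsilon$ has exactly one trajectory on $[0,T]$. Let $x^\epsilon$ be the trajectory under $u^\epsilon$ and the observations $(Y_1,\dots,Y_T)$, and let $x=x^0$. The running cost $c(x^\epsilon(t),u^\epsilon(t))$ is integrable in $t$ on $[0,T]$ and the total cost $$J^\epsilon=\int_0^T c(x^\epsilon(t),u^\epsilon(t))\,dt+h(x^\epsilon(T))$$ has finite expectation. The state $x(\tau)$ is deterministic. For every outcome and every $t\in[\tau,T]$ the state variation $\Psi(t)=\frac{\partial_+}{\partial\epsilon}x^\epsilon(t)\big|_{\epsilon=0}$ exists, and it follows the hybrid system with modes $\Psi_1$ on $[\tau,1]$ and $\Psi_i$ on $[i-1,i]$ for $2\le i\le T$, $$\Psi_1(\tau)=f(x(\tau),v)-f(x(\tau),u(\tau)),\qquad \dot\Psi_i(t)=\tfrac{\partial}{\partial x}f(x_i(t),u(t))\,\Psi_i(t),\qquad \Psi_{i+1}(i)=\tfrac{\partial}{\partial x}g(x_i(i),Y_i)\,\Psi_i(i),$$ again in integral form, with $\Psi=\Psi_i$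 on $[i-1,i)$ (on $[\tau,1)$ for $i=1$) and $\Psi(T)=\frac{\partial}{\partial x}g(x_T(T),Y_T)\Psi_T(T)$. For every outcome $\frac{\partial}{\partial x}c(x(t),u(t))^{\mathrm T}\Psi(t)$ is integrable in $t$ on $[\tau,T]$, and the right derivative of $J^\epsilon$ at $\epsilon=0$ exists and equals $$\nu=c(x(\tau),v)-c(x(\tau),u(\tau))+\int_\tau^T\tfrac{\partial}{\partial x}c(x(t),u(t))^{\mathrm T}\Psi(t)\,dt+\tfrac{\partial}{\partial x}h(x(T))^{\mathrm T}\Psi(T).$$ The random variable $\nu$ is integrable, the right derivative at $\epsilon=0$ of the expected total cost exists, and $$\frac{\partial_+}{\partial\epsilon}\mathbb E\big[J^\epsilon\big]\Big|_{\epsilon=0}=c(x(\tau),v)-c(x(\tau),u(\tau))+\mathbb E\Big[\int_\tau^T\tfrac{\partial}{\partial x}c(x(t),u(t))^{\mathrm T}\Psi(t)\,dt+\tfrac{\partial}{\partial x}h(x(T))^{\mathrm T}\Psi(T)\Big]=\mathbb E[\nu].$$ Thus the sensitivity of the expected cost is the expectation of the first-order cost sensitivity. -/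

import Mathlib

open Set Filter Topology MeasureTheory

/-- `ℝⁿ` with the Euclidean norm. -/
abbrev Vec (n : ℕ) : Type := EuclideanSpace ℝ (Fin n)

/-- `u` is piecewise continuous on `[0, T]`: continuous (relative to `[0, T]`) off a finite set of
times, with finite one-sided limits everywhere. -/
def PiecewiseContinuous {m : ℕ} (T : ℝ) (u : ℝ → Vec m) : Prop :=
  (∃ S : Finset ℝ, ∀ t ∈ Icc 0 T, t ∉ S → ContinuousWithinAt u (Icc 0 T) t) ∧
  (∀ t ∈ Ioc 0 T, ∃ l, Tendsto u (𝓝[<] t) (𝓝 l)) ∧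
  (∀ t ∈ Ico 0 T, ∃ r, Tendsto u (𝓝[>] t) (𝓝 r))

/-- The admissible controls: piecewise continuous on `[0, T]` with values in the closed ball of
radius `ρ`. -/
structure AdmissibleControl {m : ℕ} (T : ℝ) (ρ : ℝ) (u : ℝ → Vec m) : Prop where
  piecewiseContinuous : PiecewiseContinuous T u
  norm_le : ∀ t ∈ Icc 0 T, ‖u t‖ ≤ ρ

/-- Regularity and growth conditions on the flow `f` and on the jump map `g`. -/
structure DynamicsConditions {n m p : ℕ} (ρ : ℝ) (f : Vec n → Vec m → Vec n)
    (g : Vec n → Vec p → Vec n) : Prop where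
  contDiff_f : ContDiff ℝ 1 (fun z : Vec n × Vec m => f z.1 z.2)
  continuous_g : Continuous (fun z : Vec n × Vec p => g z.1 z.2)
  differentiable_g : ∀ y, Differentiable ℝ (fun x => g x y)
  lipschitz_f : ∃ K₁ : ℝ, 1 ≤ K₁ ∧ ∀ x' x'' : Vec n, ∀ u' u'' : Vec m, ‖u'‖ ≤ ρ → ‖u''‖ ≤ ρ →
    ‖f x' u' - f x'' u''‖ ≤ K₁ * (‖x' - x''‖ + ‖u' - u''‖)
  growth_g : ∃ (K₂ K₃ K₄ K₅ : ℝ) (L₁ L₂ : ℕ),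
    0 ≤ K₂ ∧ 0 ≤ K₃ ∧ 0 ≤ K₄ ∧ 0 ≤ K₅ ∧ 0 < L₁ ∧ 0 < L₂ ∧ ∀ x y,
      ‖g x y‖ ≤ K₂ + K₃ * ‖x‖ ^ L₁ + K₄ * ‖y‖ ^ L₂ + K₅ * ‖x‖ ^ L₁ * ‖y‖ ^ L₂ ∧
      ‖fderiv ℝ (fun z => g z y) x‖ ≤
        K₂ + K₃ * ‖x‖ ^ L₁ + K₄ * ‖y‖ ^ L₂ + K₅ * ‖x‖ ^ L₁ * ‖y‖ ^ L₂

/-- Regularity and growth conditions on the running cost `c` and on the terminal cost `h`. -/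
structure CostConditions {n m : ℕ} (ρ : ℝ) (c : Vec n → Vec m → ℝ) (h : Vec n → ℝ) : Prop where
  continuous_c : Continuous (fun z : Vec n × Vec m => c z.1 z.2)
  contDiff_c : ∀ w, ContDiff ℝ 1 (fun x => c x w)
  differentiable_h : Differentiable ℝ h
  growth : ∃ (K₆ K₇ : ℝ) (L₃ : ℕ), 0 ≤ K₆ ∧ 0 ≤ K₇ ∧ 0 < L₃ ∧
    (∀ x w, ‖w‖ ≤ ρ → |c x w| ≤ K₆ + K₇ * ‖x‖ ^ L₃ ∧
      ‖fderiv ℝ (fun z => c z w) x‖ ≤ K₆ + K₇ * ‖x‖ ^ L₃) ∧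
    (∀ x, |h x| ≤ K₆ + K₇ * ‖x‖ ^ L₃ ∧ ‖fderiv ℝ h x‖ ≤ K₆ + K₇ * ‖x‖ ^ L₃)

/-- `x` is the family of modes of the hybrid trajectory under the control `u` and the observations
`y 0, …, y (T - 1)`, made at the times `1, …, T`. Mode `x k` lives on `[k, k + 1]` for `k < T`. The
differential equation is in integral form, since `u` may jump. The last mode `x T` matters only at
the time `T`, where its value is the final state after the last observation. -/
structure IsHybridTrajectory {n m p T : ℕ} (f : Vec n → Vec m → Vec n) (g : Vec n → Vec p → Vec n)
    (x₀ : Vec n) (u : ℝ → Vec m) (y : Fin T → Vec p) (x : ℕ → ℝ → Vec n) : Prop where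
  init : x 0 0 = x₀
  continuousOn : ∀ k < T, ContinuousOn (x k) (Icc (k : ℝ) (k + 1))
  flow : ∀ k < T, ∀ t ∈ Icc (k : ℝ) (k + 1),
    x k t = x k k + ∫ s in (k : ℝ)..t, f (x k s) (u s)
  jump : ∀ k : Fin T, x (k + 1) (k + 1) = g (x k (k + 1)) (y k)

/-- The right continuous trajectory assembled from its modes: mode `k` on `[k, k + 1)`. -/
noncomputable def hybridState {n : ℕ} (x : ℕ → ℝ → Vec n) (t : ℝ) : Vec n := x ⌊t⌋₊ t

/-- The needle perturbation of `u`: the value `v` on `(τ - ε, τ]`, and `u` elsewhere. -/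
noncomputable def perturbedControl {m : ℕ} (u : ℝ → Vec m) (τ : ℝ) (v : Vec m) (ε : ℝ) :
    ℝ → Vec m :=
  fun t => if τ - ε < t ∧ t ≤ τ then v else u t

/-- `ψ` is the family of modes of the hybrid variational system along the trajectory with modes
`x`. Mode `ψ k` lives on `[max k τ, k + 1]`: this is `[τ, 1]` for `k = 0` and `[k, k + 1]` for
`1 ≤ k < T` when `τ ∈ (0, 1)`. The last mode `ψ T` matters only at the time `T`. -/
structure IsHybridVariation {n m p T : ℕ} (f : Vec n → Vec m → Vec n) (g : Vec n → Vec p → Vec n)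
    (u : ℝ → Vec m) (τ : ℝ) (v : Vec m) (y : Fin T → Vec p) (x ψ : ℕ → ℝ → Vec n) : Prop where
  init : ψ 0 τ = f (x 0 τ) v - f (x 0 τ) (u τ)
  continuousOn : ∀ k < T, ContinuousOn (ψ k) (Icc (max (k : ℝ) τ) (k + 1))
  flow : ∀ k < T, ∀ t ∈ Icc (max (k : ℝ) τ) (k + 1),
    ψ k t = ψ k (max (k : ℝ) τ) +
      ∫ s in (max (k : ℝ) τ)..t, fderiv ℝ (fun z => f z (u s)) (x k s) (ψ k s)
  jump : ∀ k : Fin T,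
    ψ (k + 1) (k + 1) = fderiv ℝ (fun z => g z (y k)) (x k (k + 1)) (ψ k (k + 1))

/-- The total cost over `[0, T]` of the trajectory with modes `x` under the control `u`. -/
noncomputable def totalCost {n m : ℕ} (T : ℕ) (c : Vec n → Vec m → ℝ) (h : Vec n → ℝ)
    (u : ℝ → Vec m) (x : ℕ → ℝ → Vec n) : ℝ :=
  (∫ t in (0 : ℝ)..T, c (hybridState x t) (u t)) + h (hybridState x T)

/-- The part of the first-order cost sensitivity that comes from the state variation with modes
`ψ`. -/
noncomputable def variationCost {n m : ℕ} (T : ℕ) (c : Vec n → Vec m → ℝ) (h : Vec n → ℝ)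
    (u : ℝ → Vec m) (τ : ℝ) (x ψ : ℕ → ℝ → Vec n) : ℝ :=
  (∫ t in τ..T, fderiv ℝ (fun z => c z (u t)) (hybridState x t) (hybridState ψ t)) +
    fderiv ℝ h (hybridState x T) (hybridState ψ T)

/-! A needle of width ε displaces the state at τ by ε (f(x(τ), v) - f(x(τ), u(τ))) + o(ε). After τ
the control is `u` again, so the displacement is carried by the linearised flow and, at each
observation, by the derivative of the jump. The cost feels the needle directly, through c(x(τ), v) -
c(x(τ), u(τ)), and indirectly through the displaced state. This gives ν for one outcome. Taking
expectations is then dominated convergence, which needs one integrable bound for all difference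
quotients.

The main tool is Grönwall's inequality in integral form, `norm_le_mul_exp_of_eq_add_integral`. It
yields uniqueness, a priori bounds, Lipschitz dependence on ε, and the convergence of difference
quotients of the flow. Since controls jump, the equations are treated as Carathéodory equations, for
which only measurability in time matters.

For a fixed outcome, `hasDerivWithinAt_integral_needle` computes the effect of the needle on an
integral; with integrand f it gives Ψ(τ), with integrand c the direct cost term.
`hasDerivWithinAt_flow` transports the derivative along a mode, `exists_isHybridVariation` links the
modes, and `hasDerivWithinAt_totalCost` assembles ν.

For the domination, let M = 1 + ∑ ‖Y j‖. The flow of a globally Lipschitz field enlarges a bound at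
most affinely over unit time, and a jump enlarges it polynomially. After finitely many modes the
state (`exists_polyBounded_state`) and its displacement divided by ε
(`exists_polyBounded_state_sub`) are still bounded by powers of M, hence so are the cost quotients
(`abs_totalCost_sub_le`). All powers of M are integrable because all moments of the observations are
finite. -/

/-! ### One-sided differentiation under the integral sign. -/

section RightDerivative

variable {G : Type*} [NormedAddCommGroup G] [NormedSpace ℝ G]

theorem hasDerivWithinAt_Ici_zero_iff {φ : ℝ → G} {φ' : G} :
    HasDerivWithinAt φ φ' (Ici 0) 0 ↔
      Tendsto (fun ε : ℝ => ε⁻¹ • (φ ε - φ 0)) (𝓝[>] 0) (𝓝 φ') := by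
  rw [hasDerivWithinAt_iff_tendsto_slope, Ici_sdiff_left]
  simp [slope_fun_def]

theorem Icc_mem_nhdsGT_zero {δ : ℝ} (hδ : 0 < δ) : Icc 0 δ ∈ 𝓝[>] (0 : ℝ) :=
  mem_of_superset (Ioc_mem_nhdsGT hδ) Ioc_subset_Icc_self

/-- One-sided differentiation under the integral sign at the end point `0` of the parameter. -/
theorem hasDerivWithinAt_integral_of_lipschitz_zero {α : Type*} [MeasurableSpace α]
    {μ : Measure α} {F : ℝ → α → G} {F' : α → G} {bound : α → ℝ} {δ : ℝ} (hδ : 0 < δ)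
    (hF : ∀ ε ∈ Icc 0 δ, Integrable (F ε) μ) (hb : Integrable bound μ)
    (hlip : ∀ ε ∈ Icc 0 δ, ∀ᵐ a ∂μ, ‖F ε a - F 0 a‖ ≤ ε * bound a)
    (hd : ∀ᵐ a ∂μ, HasDerivWithinAt (fun ε => F ε a) (F' a) (Ici 0) 0) :
    Integrable F' μ ∧
      HasDerivWithinAt (fun ε => ∫ a, F ε a ∂μ) (∫ a, F' a ∂μ) (Ici 0) 0 := by
  have h0 : (0 : ℝ) ∈ Icc 0 δ := ⟨le_rfl, hδ.le⟩
  have hev := Icc_mem_nhdsGT_zero hδ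
  have hmeas : ∀ᶠ ε in 𝓝[>] (0 : ℝ),
      AEStronglyMeasurable (fun a => ε⁻¹ • (F ε a - F 0 a)) μ := by
    filter_upwards [hev] with ε hε
    exact (((hF ε hε).sub (hF 0 h0)).smul ε⁻¹).aestronglyMeasurable
  have hbd : ∀ᶠ ε in 𝓝[>] (0 : ℝ), ∀ᵐ a ∂μ, ‖ε⁻¹ • (F ε a - F 0 a)‖ ≤ bound a := by
    filter_upwards [hev, self_mem_nhdsWithin] with ε hε hpos
    filter_upwards [hlip ε hε] with a ha
    have hpos' : 0 < ε := hpos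
    rw [norm_smul, norm_inv, Real.norm_of_nonneg hpos'.le, inv_mul_le_iff₀ hpos']
    exact ha
  have hlim : ∀ᵐ a ∂μ, Tendsto (fun ε : ℝ => ε⁻¹ • (F ε a - F 0 a)) (𝓝[>] 0) (𝓝 (F' a)) := by
    filter_upwards [hd] with a ha
    exact hasDerivWithinAt_Ici_zero_iff.1 ha
  constructor
  -- Measurability and the bound for `F'` are inherited along a sequence of parameters tending to
  -- `0`; the shift by `N` turns eventual properties into properties of every term.
  · obtain ⟨s, hs⟩ := (𝓝[>] (0 : ℝ)).exists_seq_tendsto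
    have hm : AEStronglyMeasurable F' μ := by
      obtain ⟨N, hN⟩ := eventually_atTop.1 (hs.eventually hmeas)
      refine aestronglyMeasurable_of_tendsto_ae atTop
        (f := fun n a => (s (n + N))⁻¹ • (F (s (n + N)) a - F 0 a)) (fun n => hN _ (by omega)) ?_
      filter_upwards [hlim] with a ha
      exact ha.comp (hs.comp (tendsto_add_atTop_nat N))
    refine hb.mono' hm ?_
    obtain ⟨N, hN⟩ := eventually_atTop.1 (hs.eventually hbd)
    have hall : ∀ᵐ a ∂μ, ∀ n : ℕ, ‖(s (n + N))⁻¹ • (F (s (n + N)) a - F 0 a)‖ ≤ bound a :=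
      ae_all_iff.2 fun n => hN _ (by omega)
    filter_upwards [hlim, hall] with a ha hbn
    exact le_of_tendsto (ha.comp (hs.comp (tendsto_add_atTop_nat N))).norm
      (Eventually.of_forall hbn)
  · rw [hasDerivWithinAt_Ici_zero_iff]
    refine (tendsto_integral_filter_of_dominated_convergence bound hmeas hbd hb hlim).congr' ?_
    filter_upwards [hev] with ε hε
    rw [integral_smul, integral_sub (hF ε hε) (hF 0 h0)]

/-- The version of `hasDerivWithinAt_integral_of_lipschitz_zero` for interval integrals with a
constant bound. -/
theorem hasDerivWithinAt_intervalIntegral_of_lipschitz_zero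
    {F : ℝ → ℝ → G} {F' : ℝ → G} {a b C δ : ℝ} (hab : a ≤ b) (hδ : 0 < δ)
    (hF : ∀ ε ∈ Icc 0 δ, IntervalIntegrable (F ε) volume a b)
    (hlip : ∀ ε ∈ Icc 0 δ, ∀ s ∈ Ioc a b, ‖F ε s - F 0 s‖ ≤ ε * C)
    (hd : ∀ s ∈ Ioc a b, HasDerivWithinAt (fun ε => F ε s) (F' s) (Ici 0) 0) :
    IntervalIntegrable F' volume a b ∧
      HasDerivWithinAt (fun ε => ∫ s in a..b, F ε s) (∫ s in a..b, F' s) (Ici 0) 0 := by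
  simp only [intervalIntegral.integral_of_le hab, intervalIntegrable_iff_integrableOn_Ioc_of_le hab]
    at hF ⊢
  refine hasDerivWithinAt_integral_of_lipschitz_zero hδ hF (bound := fun _ => C)
    (integrable_const C) (fun ε hε => ?_) ?_
  · filter_upwards [ae_restrict_mem measurableSet_Ioc] with s hs using hlip ε hε s hs
  · filter_upwards [ae_restrict_mem measurableSet_Ioc] with s hs using hd s hs

end RightDerivative

/-! ### Integral equations and Grönwall estimates. -/

section IntegralEquation

/-- **Grönwall's inequality** in integral form. -/
theorem le_mul_exp_of_le_add_integral {φ : ℝ → ℝ} {a b K δ : ℝ} (hK : 0 ≤ K)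
    (hφ : ContinuousOn φ (Icc a b))
    (h : ∀ t ∈ Icc a b, φ t ≤ δ + K * ∫ s in a..t, φ s) :
    ∀ t ∈ Icc a b, φ t ≤ δ * Real.exp (K * (t - a)) := by
  intro t ht
  have hab : a ≤ b := ht.1.trans ht.2
  -- `φ` need not be differentiable, but the right-hand side `H` is differentiable from the right,
  -- and its derivative `K * φ` is at most `K * H`.
  set H : ℝ → ℝ := fun t => δ + K * ∫ s in a..t, φ s with hH
  have hint : IntervalIntegrable φ volume a b := hφ.intervalIntegrable_of_Icc hab
  have hHc : ContinuousOn H (Icc a b) := by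
    have := intervalIntegral.continuousOn_primitive_interval
      (μ := volume) (f := φ) (a := a) (b := b) (by
        rw [uIcc_of_le hab]; exact hφ.integrableOn_Icc)
    rw [uIcc_of_le hab] at this
    exact continuousOn_const.add (continuousOn_const.mul this)
  have hHd : ∀ x ∈ Ico a b, HasDerivWithinAt H (K * φ x) (Ici x) x := by
    intro x hx
    have hIx : IntervalIntegrable φ volume a x :=
      hint.mono_set (by rw [uIcc_of_le hab, uIcc_of_le hx.1]; exact Icc_subset_Icc_right hx.2.le)
    have hc : ContinuousWithinAt φ (Ioi x) x :=
      (hφ x ⟨hx.1, hx.2.le⟩).mono_of_mem_nhdsWithin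
        (mem_of_superset (Ioo_mem_nhdsGT hx.2) fun y hy => ⟨hx.1.trans hy.1.le, hy.2.le⟩)
    have hm : StronglyMeasurableAtFilter φ (𝓝[>] x) volume :=
      ⟨Ioo x b, Ioo_mem_nhdsGT hx.2,
        (hφ.mono fun y hy => ⟨hx.1.trans hy.1.le, hy.2.le⟩).aestronglyMeasurable
          measurableSet_Ioo⟩
    have := intervalIntegral.integral_hasDerivWithinAt_right hIx (s := Ici x) (t := Ioi x) hm hc
    exact (this.const_mul K).const_add δ
  have key := le_gronwallBound_of_liminf_deriv_right_le (f := H) (f' := fun x => K * φ x)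
    (δ := δ) (K := K) (ε := 0) hHc (fun x hx r hr => (hHd x hx).liminf_right_slope_le hr)
    (by simp [hH]) (fun x hx => by
      have := mul_le_mul_of_nonneg_left (h x ⟨hx.1, hx.2.le⟩) hK
      simpa using this) t ht
  rw [gronwallBound_ε0] at key
  exact (h t ht).trans key

variable {E : Type*} [NormedAddCommGroup E] [NormedSpace ℝ E]

/-- A time dependent vector field on `[a, b]` that is uniformly Lipschitz in the state, bounded at
the origin, and measurable along continuous curves. -/
structure CaratheodoryField {E : Type*} [NormedAddCommGroup E] (a b K : ℝ) (F : ℝ → E → E) : Prop where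
  nonneg : 0 ≤ K
  lipschitz : ∀ s ∈ Icc a b, ∀ z z', ‖F s z - F s z'‖ ≤ K * ‖z - z'‖
  aestronglyMeasurable : ∀ z : ℝ → E, ContinuousOn z (Icc a b) →
    AEStronglyMeasurable (fun s => F s (z s)) (volume.restrict (Icc a b))
  bounded : ∃ B, ∀ s ∈ Icc a b, ‖F s 0‖ ≤ B

/-- `x` is a continuous solution of `x' = F t x` on `[a, b]`, in integral form. -/
def IsIntegralSolution (a b : ℝ) (F : ℝ → E → E) (x : ℝ → E) : Prop :=
  ContinuousOn x (Icc a b) ∧ ∀ t ∈ Icc a b, x t = x a + ∫ s in a..t, F s (x s)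

/-- On a curve bounded by `R` the Lipschitz condition bounds the field by `B + K * R`, and bounded
measurable functions are integrable on a compact interval. -/
theorem CaratheodoryField.intervalIntegrable {E : Type*} [NormedAddCommGroup E] {a b K : ℝ}
    {F : ℝ → E → E} (hF : CaratheodoryField a b K F) {z : ℝ → E}
    (hz : ContinuousOn z (Icc a b)) {s t : ℝ} (hs : s ∈ Icc a b) (ht : t ∈ Icc a b) :
    IntervalIntegrable (fun s => F s (z s)) volume s t := by
  have hsub : uIcc s t ⊆ Icc a b := uIcc_subset_Icc hs ht
  obtain ⟨B, hB⟩ := hF.bounded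
  obtain ⟨R, hR⟩ := isCompact_Icc.exists_bound_of_continuousOn hz
  have hint : IntegrableOn (fun s => F s (z s)) (Icc a b) volume := by
    refine Integrable.of_bound (hF.aestronglyMeasurable z hz) (B + K * R) ?_
    filter_upwards [ae_restrict_mem measurableSet_Icc] with s hs
    have h1 := hF.lipschitz s hs (z s) 0
    rw [sub_zero] at h1
    calc ‖F s (z s)‖ ≤ ‖F s 0‖ + ‖F s (z s) - F s 0‖ := by
          simpa using norm_add_le (F s 0) (F s (z s) - F s 0)
      _ ≤ B + K * R := add_le_add (hB s hs)
          (h1.trans (mul_le_mul_of_nonneg_left (hR s hs) hF.nonneg))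
  exact (hint.mono_set hsub).intervalIntegrable

/-- Needed to restart the first mode at τ. Integrability of the field along the curve is what allows
the integral to be split at `a'`. -/
theorem IsIntegralSolution.mono {a a' b K : ℝ} {F : ℝ → E → E} {x : ℝ → E}
    (hx : IsIntegralSolution a b F x) (hF : CaratheodoryField a b K F) (ha' : a' ∈ Icc a b) :
    IsIntegralSolution a' b F x := by
  refine ⟨hx.1.mono (Icc_subset_Icc_left ha'.1), fun t ht => ?_⟩
  have ht' : t ∈ Icc a b := ⟨ha'.1.trans ht.1, ht.2⟩
  have haa : a ∈ Icc a b := ⟨le_rfl, ha'.1.trans ha'.2⟩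
  rw [hx.2 t ht', hx.2 a' ha', add_assoc, intervalIntegral.integral_add_adjacent_intervals
    (hF.intervalIntegrable hx.1 haa ha') (hF.intervalIntegrable hx.1 ha' ht')]

/-- Grönwall's inequality for a vector valued curve whose integrand splits into a Lipschitz part
and a perturbation. -/
theorem norm_le_mul_exp_of_eq_add_integral {D k r : ℝ → E} {a b K δ : ℝ} (hK : 0 ≤ K)
    (hD : ContinuousOn D (Icc a b)) (hk : ∀ t ∈ Icc a b, IntervalIntegrable k volume a t)
    (hr : ∀ t ∈ Icc a b, IntervalIntegrable r volume a t)
    (hDk : ∀ s ∈ Icc a b, ‖k s‖ ≤ K * ‖D s‖)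
    (hδ : ‖D a‖ + ∫ s in a..b, ‖r s‖ ≤ δ)
    (h : ∀ t ∈ Icc a b, D t = D a + ∫ s in a..t, (k s + r s)) :
    ∀ t ∈ Icc a b, ‖D t‖ ≤ δ * Real.exp (K * (t - a)) := by
  refine le_mul_exp_of_le_add_integral hK hD.norm fun t ht => ?_
  have hab : a ≤ b := ht.1.trans ht.2
  have hbb : b ∈ Icc a b := ⟨hab, le_rfl⟩
  have hDn : IntervalIntegrable (fun s => ‖D s‖) volume a t :=
    (hD.norm.mono (Icc_subset_Icc_right ht.2)).intervalIntegrable_of_Icc ht.1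
  have h1 : ‖∫ s in a..t, k s‖ ≤ K * ∫ s in a..t, ‖D s‖ := by
    rw [← intervalIntegral.integral_const_mul]
    refine (intervalIntegral.norm_integral_le_integral_norm ht.1).trans ?_
    exact intervalIntegral.integral_mono_on ht.1 (hk t ht).norm (hDn.const_mul K)
      fun s hs => hDk s ⟨hs.1, hs.2.trans ht.2⟩
  have h2 : ‖∫ s in a..t, r s‖ ≤ ∫ s in a..b, ‖r s‖ := by
    refine (intervalIntegral.norm_integral_le_integral_norm ht.1).trans ?_
    exact intervalIntegral.integral_mono_interval le_rfl ht.1 ht.2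
      (Eventually.of_forall fun s => norm_nonneg _) (hr b hbb).norm
  rw [h t ht, intervalIntegral.integral_add (hk t ht) (hr t ht)]
  calc _ ≤ ‖D a‖ + (‖∫ s in a..t, k s‖ + ‖∫ s in a..t, r s‖) :=
        (norm_add_le _ _).trans (add_le_add le_rfl (norm_add_le _ _))
    _ ≤ _ := by linarith

namespace IsIntegralSolution

variable {a b K : ℝ} {F : ℝ → E → E}

/-- Continuous dependence of solutions on the initial value and on the vector field. -/
theorem norm_sub_le_of_perturbation {G : ℝ → E → E} {x y : ℝ → E} {δ : ℝ}
    (hx : IsIntegralSolution a b F x) (hy : IsIntegralSolution a b G y)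
    (hF : CaratheodoryField a b K F) (hG : CaratheodoryField a b K G)
    (hδ : ‖x a - y a‖ + ∫ s in a..b, ‖F s (y s) - G s (y s)‖ ≤ δ) :
    ∀ t ∈ Icc a b, ‖x t - y t‖ ≤ δ * Real.exp (K * (t - a)) := by
  intro t ht
  have haa : a ∈ Icc a b := ⟨le_rfl, ht.1.trans ht.2⟩
  -- The defect of the two fields is measured along `y` alone, so that the remaining part is
  -- controlled by the Lipschitz constant of `F`.
  refine norm_le_mul_exp_of_eq_add_integral (D := fun t => x t - y t)
    (k := fun s => F s (x s) - F s (y s)) (r := fun s => F s (y s) - G s (y s)) hF.nonneg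
    (hx.1.sub hy.1)
    (fun t ht => (hF.intervalIntegrable hx.1 haa ht).sub (hF.intervalIntegrable hy.1 haa ht))
    (fun t ht => (hF.intervalIntegrable hy.1 haa ht).sub (hG.intervalIntegrable hy.1 haa ht))
    (fun s hs => hF.lipschitz s hs _ _) hδ (fun t ht => ?_) t ht
  simp only [sub_add_sub_cancel]
  rw [intervalIntegral.integral_sub (hF.intervalIntegrable hx.1 haa ht)
    (hG.intervalIntegrable hy.1 haa ht), hx.2 t ht, hy.2 t ht]
  abel

theorem norm_sub_le {x y : ℝ → E} (hx : IsIntegralSolution a b F x)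
    (hy : IsIntegralSolution a b F y) (hF : CaratheodoryField a b K F) :
    ∀ t ∈ Icc a b, ‖x t - y t‖ ≤ ‖x a - y a‖ * Real.exp (K * (t - a)) :=
  hx.norm_sub_le_of_perturbation hy hF hF (by simp)

theorem eqOn {x y : ℝ → E} (hx : IsIntegralSolution a b F x)
    (hy : IsIntegralSolution a b F y) (hF : CaratheodoryField a b K F) (h0 : x a = y a) :
    EqOn x y (Icc a b) := fun t ht => by
  have := hx.norm_sub_le hy hF t ht
  rw [h0, sub_self, norm_zero, zero_mul] at this
  exact sub_eq_zero.1 (norm_le_zero_iff.1 this)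

/-- Grönwall applied to the splitting of the field into its increment from the origin, which is
Lipschitz, and its value there, which is bounded by `B`. -/
theorem norm_le {x : ℝ → E} {B : ℝ} (hx : IsIntegralSolution a b F x)
    (hF : CaratheodoryField a b K F) (hB : ∀ s ∈ Icc a b, ‖F s 0‖ ≤ B) :
    ∀ t ∈ Icc a b, ‖x t‖ ≤ (‖x a‖ + B * (b - a)) * Real.exp (K * (t - a)) := by
  intro t ht
  have hab : a ≤ b := ht.1.trans ht.2
  have haa : a ∈ Icc a b := ⟨le_rfl, hab⟩
  have h0 : ∀ t ∈ Icc a b, IntervalIntegrable (fun s => F s 0) volume a t := fun t ht =>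
    hF.intervalIntegrable (z := fun _ => 0) continuousOn_const haa ht
  refine norm_le_mul_exp_of_eq_add_integral (D := x)
    (k := fun s => F s (x s) - F s 0) (r := fun s => F s 0) hF.nonneg hx.1
    (fun t ht => (hF.intervalIntegrable hx.1 haa ht).sub (h0 t ht)) h0
    (fun s hs => by simpa using hF.lipschitz s hs (x s) 0) ?_ (fun t ht => ?_) t ht
  · have : ∫ s in a..b, ‖F s 0‖ ≤ ∫ s in a..b, B :=
      intervalIntegral.integral_mono_on hab (h0 b ⟨hab, le_rfl⟩).norm (by simp) hB
    rw [intervalIntegral.integral_const, smul_eq_mul] at this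
    linarith
  · simp only [sub_add_cancel]
    exact hx.2 t ht

end IsIntegralSolution

end IntegralEquation

/-! ### Global existence for one mode and for linked modes. -/

section Existence

variable {E : Type*} [NormedAddCommGroup E] [NormedSpace ℝ E]

/-- This is the contraction factor of the weighted Picard map. The left-hand side is `K / lam` times
a number below `1`; the choice `2 * K + 1` keeps `lam` positive even when `K = 0`. -/
theorem integral_mul_exp_le {K lam a t : ℝ} (hK : 0 ≤ K) (hl : 2 * K + 1 = lam) :
    Real.exp (-(lam * (t - a))) * ∫ s in a..t, K * Real.exp (lam * (s - a)) ≤ 1 / 2 := by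
  have hl0 : 0 < lam := by linarith
  have hder : ∀ s ∈ uIcc a t, HasDerivAt (fun s => K / lam * Real.exp (lam * (s - a)))
      (K * Real.exp (lam * (s - a))) s := by
    intro s _
    have h1 : HasDerivAt (fun s => lam * (s - a)) lam s := by
      simpa using ((hasDerivAt_id s).sub_const a).const_mul lam
    exact (h1.exp.const_mul (K / lam)).congr_deriv (by field_simp)
  rw [intervalIntegral.integral_eq_sub_of_hasDerivAt hder
    (Continuous.intervalIntegrable (by fun_prop) _ _), ← mul_sub]
  have h2 : K / lam ≤ 1 / 2 := by rw [div_le_div_iff₀ hl0 two_pos]; linarith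
  have h3 : Real.exp (-(lam * (t - a))) * Real.exp (lam * (t - a)) = 1 := by
    rw [← Real.exp_add]; simp
  have h4 : 0 ≤ K / lam := by positivity
  have h5 : 0 < Real.exp (-(lam * (t - a))) := Real.exp_pos _
  simp only [sub_self, mul_zero, Real.exp_zero]
  calc _ = K / lam * (1 - Real.exp (-(lam * (t - a)))) := by
        linear_combination (K / lam) * h3
    _ ≤ K / lam := by nlinarith
    _ ≤ 1 / 2 := h2

/-- Global existence for Carathéodory fields: the Picard map is a contraction for an exponentially
weighted supremum norm. -/
theorem CaratheodoryField.exists_isIntegralSolution [CompleteSpace E] {a b K : ℝ}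
    {F : ℝ → E → E} (hF : CaratheodoryField a b K F) (hab : a ≤ b) (z₀ : E) :
    ∃ x, x a = z₀ ∧ IsIntegralSolution a b F x := by
  obtain ⟨lam, hlam⟩ : ∃ lam, 2 * K + 1 = lam := ⟨_, rfl⟩
  have haa : a ∈ Icc a b := ⟨le_rfl, hab⟩
  -- The unknown `w` is the solution divided by the exponential weight and `W w` restores the
  -- weight, so the usual supremum norm of `w` plays the role of the weighted norm.
  set W : C(Icc a b, E) → ℝ → E := fun w s => Real.exp (lam * (s - a)) • IccExtend hab w s with hW
  have hWc : ∀ w, Continuous (W w) := fun w =>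
    (by fun_prop : Continuous fun s => Real.exp (lam * (s - a))).smul (w.continuous.Icc_extend')
  have hWi : ∀ w, ∀ t ∈ Icc a b, IntervalIntegrable (fun s => F s (W w s)) volume a t :=
    fun w t ht => hF.intervalIntegrable (hWc w).continuousOn haa ht
  set Q : C(Icc a b, E) → ℝ → E := fun w t => z₀ + ∫ s in a..t, F s (W w s) with hQ
  have hQc : ∀ w, ContinuousOn (Q w) (Icc a b) := by
    intro w
    have h1 := hWi w b ⟨hab, le_rfl⟩
    have := intervalIntegral.continuousOn_primitive_interval' h1 left_mem_uIcc
    rw [uIcc_of_le hab] at this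
    exact continuousOn_const.add this
  set Φ : C(Icc a b, E) → C(Icc a b, E) := fun w =>
    ⟨fun t => Real.exp (-(lam * ((t : ℝ) - a))) • Q w t,
      (by fun_prop : Continuous fun t : Icc a b => Real.exp (-(lam * ((t : ℝ) - a)))).smul
        (continuousOn_iff_continuous_domRestrict.1 (hQc w))⟩ with hΦ
  have hcontr : ContractingWith (1 / 2) Φ := by
    refine ⟨by rw [← NNReal.coe_lt_coe]; norm_num, LipschitzWith.of_dist_le_mul fun w w' => ?_⟩
    rw [ContinuousMap.dist_le (by positivity)]
    intro t
    have hd : 0 ≤ dist w w' := dist_nonneg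
    have hpt : ∀ s ∈ Icc a (t : ℝ), ‖F s (W w s) - F s (W w' s)‖ ≤
        (K * Real.exp (lam * (s - a))) * dist w w' := by
      intro s hs
      have hs' : s ∈ Icc a b := ⟨hs.1, hs.2.trans t.2.2⟩
      refine (hF.lipschitz s hs' _ _).trans ?_
      rw [mul_assoc]
      refine mul_le_mul_of_nonneg_left ?_ hF.nonneg
      simp only [hW]
      rw [← smul_sub, norm_smul, Real.norm_of_nonneg (Real.exp_pos _).le, ← dist_eq_norm]
      exact mul_le_mul_of_nonneg_left (ContinuousMap.dist_apply_le_dist _) (Real.exp_pos _).le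
    have hint : ‖∫ s in a..t, (F s (W w s) - F s (W w' s))‖ ≤
        (∫ s in a..t, K * Real.exp (lam * (s - a))) * dist w w' := by
      rw [← intervalIntegral.integral_mul_const]
      refine (intervalIntegral.norm_integral_le_integral_norm t.2.1).trans ?_
      exact intervalIntegral.integral_mono_on t.2.1
        ((hWi w t t.2).sub (hWi w' t t.2)).norm
        (Continuous.intervalIntegrable (by fun_prop) _ _) hpt
    have he : 0 < Real.exp (-(lam * ((t : ℝ) - a))) := Real.exp_pos _
    calc dist (Φ w t) (Φ w' t)
        = Real.exp (-(lam * ((t : ℝ) - a))) *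
            ‖∫ s in a..t, (F s (W w s) - F s (W w' s))‖ := by
          rw [dist_eq_norm, intervalIntegral.integral_sub (hWi w t t.2) (hWi w' t t.2)]
          simp only [hΦ, hQ, ContinuousMap.coe_mk]
          rw [← smul_sub, norm_smul, Real.norm_of_nonneg he.le, add_sub_add_left_eq_sub]
      _ ≤ Real.exp (-(lam * ((t : ℝ) - a))) *
            ((∫ s in a..t, K * Real.exp (lam * (s - a))) * dist w w') :=
          mul_le_mul_of_nonneg_left hint he.le
      _ ≤ 1 / 2 * dist w w' := by
          rw [← mul_assoc]
          exact mul_le_mul_of_nonneg_right (integral_mul_exp_le hF.nonneg hlam) hd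
      _ = ((1 / 2 : NNReal) : ℝ) * dist w w' := by norm_num
  set w := hcontr.fixedPoint
  have hfix : Φ w = w := hcontr.fixedPoint_isFixedPt
  have hWQ : ∀ t ∈ Icc a b, W w t = Q w t := by
    intro t ht
    have h1 : Φ w ⟨t, ht⟩ = w ⟨t, ht⟩ := by rw [hfix]
    simp only [hW]
    rw [IccExtend_of_mem hab _ ht, ← h1]
    simp only [hΦ, ContinuousMap.coe_mk]
    rw [smul_smul, ← Real.exp_add]
    simp
  refine ⟨W w, ?_, (hWc w).continuousOn, fun t ht => ?_⟩
  · rw [hWQ a haa]; simp [hQ]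
  · rw [hWQ a haa, hWQ t ht]; simp [hQ]

/-- Existence of hybrid solutions: flows on the intervals `[a k, b k]`, linked by jumps. -/
theorem exists_hybrid_solution [CompleteSpace E] {N : ℕ} {a b : ℕ → ℝ} {K : ℝ}
    {F : ℕ → ℝ → E → E} (hab : ∀ k < N, a k ≤ b k)
    (hF : ∀ k < N, CaratheodoryField (a k) (b k) K (F k)) (J : ℕ → E → E) (z₀ : E) :
    ∃ x : ℕ → ℝ → E, x 0 (a 0) = z₀ ∧ (∀ k < N, IsIntegralSolution (a k) (b k) (F k) (x k)) ∧
      ∀ k, x (k + 1) (a (k + 1)) = J k (x k (b k)) := by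
  -- For `k ≥ N` the curve is constant; mode `N` thus merely records the state after the last jump.
  have : ∀ (k : ℕ) (z : E), ∃ y : ℝ → E, y (a k) = z ∧
      (k < N → IsIntegralSolution (a k) (b k) (F k) y) := by
    intro k z
    by_cases hk : k < N
    · obtain ⟨y, hy⟩ := (hF k hk).exists_isIntegralSolution (hab k hk) z
      exact ⟨y, hy.1, fun _ => hy.2⟩
    · exact ⟨fun _ => z, rfl, fun h => absurd h hk⟩
  choose S hS0 hS using this
  refine ⟨fun k => Nat.rec (S 0 z₀) (fun k y => S (k + 1) (J k (y (b k)))) k, hS0 _ _, ?_, ?_⟩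
  · intro k hk
    cases k with
    | zero => exact hS _ _ hk
    | succ k => exact hS _ _ hk
  · intro k
    exact hS0 _ _

end Existence

/-! ### Differentiating flows and shrinking integrals. -/

section Sensitivity

variable {E : Type*} [NormedAddCommGroup E] [NormedSpace ℝ E]

/-- Right differentiability of a flow with respect to a parameter on which only the initial value
depends; the derivative solves the linearised equation. -/
theorem hasDerivWithinAt_flow {a b K C δ : ℝ} {F : ℝ → E → E} {A : ℝ → E →L[ℝ] E}
    {x : ℝ → ℝ → E} {ψ : ℝ → E} (hF : CaratheodoryField a b K F)
    (hA : CaratheodoryField a b K (fun s z => A s z)) (hδ : 0 < δ)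
    (hx : ∀ ε ∈ Icc 0 δ, IsIntegralSolution a b F (x ε))
    (hC : ∀ ε ∈ Icc 0 δ, ∀ t ∈ Icc a b, ‖x ε t - x 0 t‖ ≤ ε * C)
    (hFA : ∀ s ∈ Icc a b, HasFDerivAt (F s) (A s) (x 0 s))
    (hψ : IsIntegralSolution a b (fun s z => A s z) ψ)
    (hinit : HasDerivWithinAt (fun ε => x ε a) (ψ a) (Ici 0) 0) :
    ∀ t ∈ Icc a b, HasDerivWithinAt (fun ε => x ε t) (ψ t) (Ici 0) 0 := by
  intro t ht
  have hab : a ≤ b := ht.1.trans ht.2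
  have haa : a ∈ Icc a b := ⟨le_rfl, hab⟩
  have hbb : b ∈ Icc a b := ⟨hab, le_rfl⟩
  have h0 : (0 : ℝ) ∈ Icc 0 δ := ⟨le_rfl, hδ.le⟩
  have hx0 := hx 0 h0
  -- The remainder of the first-order expansion of the field along the nominal solution.
  set r : ℝ → ℝ → E := fun ε s => F s (x ε s) - F s (x 0 s) - A s (x ε s - x 0 s) with hr
  have hrint : ∀ ε ∈ Icc 0 δ, ∀ t ∈ Icc a b, IntervalIntegrable (r ε) volume a t := fun ε hε t ht =>
    ((hF.intervalIntegrable (hx ε hε).1 haa ht).sub (hF.intervalIntegrable hx0.1 haa ht)).sub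
      (hA.intervalIntegrable ((hx ε hε).1.sub hx0.1) haa ht)
  have hO : ∀ s ∈ Icc a b, (fun ε => x ε s - x 0 s) =O[𝓝[Ici 0] 0] fun ε : ℝ => ε := by
    intro s hs
    refine Asymptotics.IsBigO.of_bound C ?_
    have : Icc 0 δ ∈ 𝓝[Ici 0] (0 : ℝ) := Icc_mem_nhdsGE hδ
    filter_upwards [this] with ε hε
    rw [Real.norm_of_nonneg hε.1, mul_comm]
    exact hC ε hε s hs
  -- The remainder is at most `ε * (2 * K * C)` everywhere and o(ε) at each time, so the integral of
  -- its norm is o(ε): it has right derivative `0`.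
  have hrd := (hasDerivWithinAt_intervalIntegral_of_lipschitz_zero (F := fun ε s => ‖r ε s‖)
    (F' := fun _ => 0) (C := 2 * K * C) hab hδ (fun ε hε => (hrint ε hε b hbb).norm)
    (fun ε hε s hs => by
      have hs' : s ∈ Icc a b := ⟨hs.1.le, hs.2⟩
      have h1 := hF.lipschitz s hs' (x ε s) (x 0 s)
      have h2 := hA.lipschitz s hs' (x ε s - x 0 s) 0
      have h3 := mul_le_mul_of_nonneg_left (hC ε hε s hs') hF.nonneg
      simp only [map_zero, sub_zero] at h2
      have h4 : r 0 s = 0 := by simp [hr]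
      rw [h4, norm_zero, sub_zero, norm_norm]
      calc ‖r ε s‖ ≤ ‖F s (x ε s) - F s (x 0 s)‖ + ‖A s (x ε s - x 0 s)‖ := norm_sub_le _ _
        _ ≤ ε * (2 * K * C) := by linarith)
    (fun s hs => by
      have hs' : s ∈ Icc a b := ⟨hs.1.le, hs.2⟩
      have h1 := (hFA s hs').isLittleO
      have htend : Tendsto (fun ε => x ε s) (𝓝[Ici 0] 0) (𝓝 (x 0 s)) := by
        have := (hO s hs').trans_tendsto (tendsto_nhdsWithin_of_tendsto_nhds tendsto_id)
        simpa using this.add_const (x 0 s)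
      have h2 := (h1.comp_tendsto htend).trans_isBigO (hO s hs')
      rw [hasDerivWithinAt_iff_isLittleO]
      have h4 : r 0 s = 0 := by simp [hr]
      simpa [h4, hr, Function.comp_def] using h2.norm_left)).2
  rw [hasDerivWithinAt_Ici_zero_iff] at hrd hinit ⊢
  rw [tendsto_iff_norm_sub_tendsto_zero] at hinit ⊢
  have hr0 : ∀ s, r 0 s = 0 := fun s => by simp [hr]
  simp only [hr0, norm_zero, intervalIntegral.integral_zero, sub_zero, smul_eq_mul] at hrd
  have hlim := (hinit.add hrd).mul_const (Real.exp (K * (t - a)))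
  rw [add_zero, zero_mul] at hlim
  refine squeeze_zero' (Eventually.of_forall fun _ => norm_nonneg _) ?_ hlim
  filter_upwards [Icc_mem_nhdsGT_zero hδ, self_mem_nhdsWithin] with ε hε hpos
  have hpos' : (0 : ℝ) < ε := hpos
  have hDc : ContinuousOn (fun t => ε⁻¹ • (x ε t - x 0 t) - ψ t) (Icc a b) :=
    (((hx ε hε).1.sub hx0.1).const_smul ε⁻¹).sub hψ.1
  -- The error `D` of the difference quotient solves the linearised equation with forcing `ε⁻¹ • r
  -- ε`, and Grönwall bounds it by the initial error plus the integrated forcing, both tending to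
  -- `0`.
  refine norm_le_mul_exp_of_eq_add_integral
    (D := fun t => ε⁻¹ • (x ε t - x 0 t) - ψ t)
    (k := fun s => A s (ε⁻¹ • (x ε s - x 0 s) - ψ s)) (r := fun s => ε⁻¹ • r ε s) hF.nonneg hDc
    (fun t ht => hA.intervalIntegrable hDc haa ht) (fun t ht => (hrint ε hε t ht).smul ε⁻¹)
    (fun s hs => by simpa using hA.lipschitz s hs (ε⁻¹ • (x ε s - x 0 s) - ψ s) 0) ?_
    (fun t ht => ?_) t ht
  · simp only [norm_smul, norm_inv, Real.norm_of_nonneg hpos'.le,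
      intervalIntegral.integral_const_mul]
    exact le_rfl
  · have h1 : ∀ s, A s (ε⁻¹ • (x ε s - x 0 s) - ψ s) + ε⁻¹ • r ε s =
        ε⁻¹ • (F s (x ε s) - F s (x 0 s)) - A s (ψ s) := by
      intro s
      simp only [hr, map_sub, map_smul, smul_sub]
      abel
    simp only [h1]
    have i1 := hF.intervalIntegrable (hx ε hε).1 haa ht
    have i2 := hF.intervalIntegrable hx0.1 haa ht
    have i3 := hA.intervalIntegrable hψ.1 haa ht
    have i4 : IntervalIntegrable (fun s => ε⁻¹ • (F s (x ε s) - F s (x 0 s))) volume a t :=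
      (i1.sub i2).smul ε⁻¹
    rw [intervalIntegral.integral_sub i4 i3, intervalIntegral.integral_smul,
      intervalIntegral.integral_sub i1 i2, (hx ε hε).2 t ht, hx0.2 t ht, hψ.2 t ht]
    simp only [smul_sub, smul_add]
    abel

/-- The right derivative of the integral over the shrinking interval `(τ - ε, τ]`. -/
theorem hasDerivWithinAt_integral_sub_left {p : ℝ → ℝ → E} {L : E} {τ δ : ℝ} [CompleteSpace E]
    (hδ : 0 < δ) (hp : ∀ ε ∈ Icc 0 δ, IntervalIntegrable (p ε) volume (τ - ε) τ)
    (hlim : Tendsto (fun z : ℝ × ℝ => p z.1 z.2) (𝓝[>] 0 ×ˢ 𝓝[≤] τ) (𝓝 L)) :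
    HasDerivWithinAt (fun ε => ∫ s in (τ - ε)..τ, p ε s) L (Ici 0) 0 := by
  rw [hasDerivWithinAt_Ici_zero_iff, Metric.tendsto_nhds]
  intro η hη
  have h1 := (Metric.tendsto_nhds.1 hlim) (η / 2) (half_pos hη)
  -- The joint limit supplies one left neighbourhood of τ that serves all small ε; once `ε ≤ τ - l`
  -- the whole interval of integration lies in it.
  obtain ⟨U, hU, V, hV, hUV⟩ := eventually_prod_iff.1 h1
  obtain ⟨l, hl, hlV⟩ := (mem_nhdsLE_iff_exists_Ioc_subset' (show τ - 1 < τ by linarith)).1 hV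
  have hl' : l < τ := hl
  filter_upwards [hU, Icc_mem_nhdsGT_zero hδ, Ioc_mem_nhdsGT (show 0 < τ - l by linarith)]
    with ε hεU hεδ hε
  have hle : τ - ε ≤ τ := by linarith [hε.1]
  have hbd : ‖∫ s in (τ - ε)..τ, (p ε s - L)‖ ≤ η / 2 * |τ - (τ - ε)| := by
    refine intervalIntegral.norm_integral_le_of_norm_le_const fun s hs => ?_
    rw [uIoc_of_le hle] at hs
    rw [← dist_eq_norm]
    exact (hUV hεU (hlV ⟨by linarith [hs.1, hε.2], hs.2⟩)).le
  rw [intervalIntegral.integral_sub (hp ε hεδ) intervalIntegrable_const,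
    intervalIntegral.integral_const, sub_sub_cancel, abs_of_pos hε.1] at hbd
  rw [sub_zero, intervalIntegral.integral_same, sub_zero, dist_eq_norm]
  have : ε⁻¹ • (∫ s in (τ - ε)..τ, p ε s) - L = ε⁻¹ • ((∫ s in (τ - ε)..τ, p ε s) - ε • L) := by
    rw [smul_sub, smul_smul, inv_mul_cancel₀ hε.1.ne', one_smul]
  rw [this, norm_smul, norm_inv, Real.norm_of_nonneg hε.1.le, inv_mul_lt_iff₀ hε.1]
  nlinarith [hε.1]

end Sensitivity

/-! ### Bounded measurable controls and the fields they generate. -/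

section Controls

variable {n m p T : ℕ}

/-- A measurable control on `[0, T]` with values in the closed ball of radius `ρ`. -/
structure BoundedControl (T ρ : ℝ) (u : ℝ → Vec m) : Prop where
  aestronglyMeasurable : AEStronglyMeasurable u (volume.restrict (Icc 0 T))
  norm_le : ∀ t ∈ Icc 0 T, ‖u t‖ ≤ ρ

/-- The finitely many exceptional times form a null set. Passing to measurable controls makes
stability under needle perturbations immediate; the only continuity still used is that of `u` from
the left at τ. -/
theorem AdmissibleControl.boundedControl {T ρ : ℝ} {u : ℝ → Vec m}
    (hu : AdmissibleControl T ρ u) : BoundedControl T ρ u := by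
  refine ⟨?_, hu.norm_le⟩
  obtain ⟨S, hS⟩ := hu.piecewiseContinuous.1
  have h1 : ContinuousOn u (Icc 0 T \ S) := fun t ht => (hS t ht.1 ht.2).mono sdiff_subset
  have h2 : (Icc 0 T \ (S : Set ℝ) : Set ℝ) =ᵐ[volume] Icc 0 T :=
    sdiff_null_ae_eq_self (S.finite_toSet.measure_zero volume)
  rw [← Measure.restrict_congr_set h2]
  exact h1.aestronglyMeasurable (measurableSet_Icc.diff S.finite_toSet.measurableSet)

theorem BoundedControl.perturbed {T ρ : ℝ} {u : ℝ → Vec m} (hu : BoundedControl T ρ u)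
    {v : Vec m} (hv : ‖v‖ ≤ ρ) (τ ε : ℝ) : BoundedControl T ρ (perturbedControl u τ v ε) := by
  constructor
  · have : perturbedControl u τ v ε = (Ioc (τ - ε) τ).piecewise (fun _ => v) u := by
      ext1 t
      simp [perturbedControl, Set.piecewise]
    rw [this]
    exact AEStronglyMeasurable.piecewise measurableSet_Ioc aestronglyMeasurable_const
      hu.aestronglyMeasurable.restrict
  · intro t ht
    unfold perturbedControl
    split_ifs
    exacts [hv, hu.norm_le t ht]

theorem perturbedControl_of_lt {u : ℝ → Vec m} {τ ε t : ℝ} {v : Vec m} (h : τ < t) :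
    perturbedControl u τ v ε t = u t := if_neg fun h' => h.not_ge h'.2

theorem perturbedControl_of_le {u : ℝ → Vec m} {τ ε t : ℝ} {v : Vec m} (h : t ≤ τ - ε) :
    perturbedControl u τ v ε t = u t := if_neg fun h' => h.not_gt h'.1

theorem perturbedControl_of_mem {u : ℝ → Vec m} {τ ε t : ℝ} {v : Vec m} (h : t ∈ Ioc (τ - ε) τ) :
    perturbedControl u τ v ε t = v := if_pos h

theorem perturbedControl_zero {u : ℝ → Vec m} {τ : ℝ} {v : Vec m} :
    perturbedControl u τ v 0 = u := by
  ext1 t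
  rcases le_or_gt t τ with h | h
  · exact perturbedControl_of_le (by simpa using h)
  · exact perturbedControl_of_lt h

variable {ρ : ℝ} {u : ℝ → Vec m} {a b : ℝ}

theorem BoundedControl.aestronglyMeasurable_comp {G : Type*} [TopologicalSpace G] {Tf : ℝ}
    (hu : BoundedControl Tf ρ u) (ha : 0 ≤ a) (hb : b ≤ Tf) {q : Vec n → Vec m → G}
    (hq : Continuous fun z : Vec n × Vec m => q z.1 z.2) {x : ℝ → Vec n}
    (hx : ContinuousOn x (Icc a b)) :
    AEStronglyMeasurable (fun s => q (x s) (u s)) (volume.restrict (Icc a b)) :=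
  hq.comp_aestronglyMeasurable ((hx.aestronglyMeasurable measurableSet_Icc).prodMk
    (hu.aestronglyMeasurable.mono_set (Icc_subset_Icc ha hb)))

/-- State and control stay in a product of two closed balls, which is compact in finite dimension,
so `q` is bounded there. -/
theorem BoundedControl.intervalIntegrable_comp {G : Type*} [NormedAddCommGroup G] {Tf : ℝ}
    (hu : BoundedControl Tf ρ u) (ha : 0 ≤ a) (hab : a ≤ b) (hb : b ≤ Tf) {q : Vec n → Vec m → G}
    (hq : Continuous fun z : Vec n × Vec m => q z.1 z.2) {x : ℝ → Vec n}
    (hx : ContinuousOn x (Icc a b)) :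
    IntervalIntegrable (fun s => q (x s) (u s)) volume a b := by
  obtain ⟨R, hR⟩ := isCompact_Icc.exists_bound_of_continuousOn hx
  obtain ⟨C, hC⟩ := ((isCompact_closedBall (0 : Vec n) R).prod
    (isCompact_closedBall (0 : Vec m) ρ)).exists_bound_of_continuousOn hq.continuousOn
  have : IntegrableOn (fun s => q (x s) (u s)) (uIcc a b) := by
    rw [uIcc_of_le hab]
    refine Integrable.of_bound (hu.aestronglyMeasurable_comp ha hb hq hx) C ?_
    filter_upwards [ae_restrict_mem measurableSet_Icc] with s hs
    exact hC (x s, u s) ⟨by simpa using hR s hs,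
      by simpa using hu.norm_le s ⟨ha.trans hs.1, hs.2.trans hb⟩⟩
  exact this.intervalIntegrable

variable {f : Vec n → Vec m → Vec n} {K : ℝ}

/-- Two controls in the ball are at most `2 * ρ` apart; `v` serves as the reference point. -/
theorem exists_bound_of_lipschitz {v : Vec m} (hv : ‖v‖ ≤ ρ) (hK : 0 ≤ K)
    (hL : ∀ x' x'' : Vec n, ∀ u' u'' : Vec m, ‖u'‖ ≤ ρ → ‖u''‖ ≤ ρ →
      ‖f x' u' - f x'' u''‖ ≤ K * (‖x' - x''‖ + ‖u' - u''‖)) :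
    ∃ B, 0 ≤ B ∧ ∀ w, ‖w‖ ≤ ρ → ‖f 0 w‖ ≤ B := by
  have hρ : 0 ≤ ρ := (norm_nonneg v).trans hv
  refine ⟨‖f 0 v‖ + K * (2 * ρ), by positivity, fun w hw => ?_⟩
  have h1 := hL 0 0 w v hw hv
  have h2 : ‖w - v‖ ≤ 2 * ρ := (norm_sub_le _ _).trans (by linarith)
  have h3 := mul_le_mul_of_nonneg_left h2 hK
  rw [sub_self, norm_zero, zero_add] at h1
  have h4 := norm_sub_norm_le (f 0 w) (f 0 v)
  linarith

theorem BoundedControl.caratheodoryField {Tf B : ℝ} (hu : BoundedControl Tf ρ u)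
    (hf : Continuous fun z : Vec n × Vec m => f z.1 z.2) (hK : 0 ≤ K)
    (hL : ∀ x' x'' : Vec n, ∀ u' u'' : Vec m, ‖u'‖ ≤ ρ → ‖u''‖ ≤ ρ →
      ‖f x' u' - f x'' u''‖ ≤ K * (‖x' - x''‖ + ‖u' - u''‖))
    (hB : ∀ w, ‖w‖ ≤ ρ → ‖f 0 w‖ ≤ B) (ha : 0 ≤ a) (hb : b ≤ Tf) :
    CaratheodoryField a b K (fun s z => f z (u s)) where
  nonneg := hK
  lipschitz s hs z z' := by
    have h := hu.norm_le s ⟨ha.trans hs.1, hs.2.trans hb⟩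
    simpa using hL z z' _ _ h h
  aestronglyMeasurable z hz := hu.aestronglyMeasurable_comp ha hb hf hz
  bounded := ⟨B, fun s hs => hB _ (hu.norm_le s ⟨ha.trans hs.1, hs.2.trans hb⟩)⟩

theorem hasFDerivAt_fst_of_contDiff (hf : ContDiff ℝ 1 fun z : Vec n × Vec m => f z.1 z.2)
    (z : Vec n) (w : Vec m) :
    HasFDerivAt (fun z => f z w) ((fderiv ℝ (fun z : Vec n × Vec m => f z.1 z.2) (z, w)).comp
      (ContinuousLinearMap.inl ℝ (Vec n) (Vec m))) z := by
  have h1 := ((hf.differentiable one_ne_zero) (z, w)).hasFDerivAt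
  exact HasFDerivAt.comp (g := fun z : Vec n × Vec m => f z.1 z.2) (f := fun e => (e, w)) z h1
    (hasFDerivAt_prodMk_left z w)

/-- Joint continuity, obtained by restricting the full derivative to the state directions, makes the
linearised field measurable in time. -/
theorem continuous_fderiv_fst (hf : ContDiff ℝ 1 fun z : Vec n × Vec m => f z.1 z.2) :
    Continuous fun z : Vec n × Vec m => fderiv ℝ (fun z' => f z' z.2) z.1 := by
  have h1 : (fun z : Vec n × Vec m => fderiv ℝ (fun z' => f z' z.2) z.1) = fun z =>
      (fderiv ℝ (fun z : Vec n × Vec m => f z.1 z.2) z).comp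
        (ContinuousLinearMap.inl ℝ (Vec n) (Vec m)) :=
    funext fun z => (hasFDerivAt_fst_of_contDiff hf z.1 z.2).fderiv
  rw [h1]
  exact (hf.continuous_fderiv one_ne_zero).clm_comp continuous_const

/-- The linearisation of the controlled field along a continuous curve. -/
theorem BoundedControl.caratheodoryField_linearised {Tf : ℝ} (hu : BoundedControl Tf ρ u)
    (hf : ContDiff ℝ 1 fun z : Vec n × Vec m => f z.1 z.2) (hK : 0 ≤ K)
    (hL : ∀ x' x'' : Vec n, ∀ u' u'' : Vec m, ‖u'‖ ≤ ρ → ‖u''‖ ≤ ρ →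
      ‖f x' u' - f x'' u''‖ ≤ K * (‖x' - x''‖ + ‖u' - u''‖))
    (ha : 0 ≤ a) (hb : b ≤ Tf) {x : ℝ → Vec n} (hx : ContinuousOn x (Icc a b)) :
    CaratheodoryField a b K (fun s z => fderiv ℝ (fun z' => f z' (u s)) (x s) z) where
  nonneg := hK
  lipschitz s hs z z' := by
    have h := hu.norm_le s ⟨ha.trans hs.1, hs.2.trans hb⟩
    have h1 : ‖fderiv ℝ (fun z' => f z' (u s)) (x s)‖ ≤ K :=
      norm_fderiv_le_of_lip' ℝ hK (Eventually.of_forall fun z => by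
        simpa using hL z (x s) _ _ h h)
    rw [← map_sub]
    exact ContinuousLinearMap.le_of_opNorm_le _ h1 _
  aestronglyMeasurable z hz := by
    have h1 := hu.aestronglyMeasurable_comp ha hb
      (q := fun y w => fderiv ℝ (fun z' => f z' w) y) (continuous_fderiv_fst hf) hx
    exact (isBoundedBilinearMap_apply (𝕜 := ℝ) (E := Vec n) (F := Vec n)).continuous
      |>.comp_aestronglyMeasurable (h1.prodMk (hz.aestronglyMeasurable measurableSet_Icc))
  bounded := ⟨0, fun s _ => by simp⟩

end Controls

/-! ### Hybrid trajectories: existence, uniqueness, integration by modes. -/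

section Hybrid

variable {n m p T : ℕ} {f : Vec n → Vec m → Vec n} {g : Vec n → Vec p → Vec n} {x₀ : Vec n}
  {u : ℝ → Vec m} {y : Fin T → Vec p} {x : ℕ → ℝ → Vec n}

theorem hybridState_of_mem_Ico {k : ℕ} {t : ℝ} (ht : t ∈ Ico (k : ℝ) (k + 1)) :
    hybridState x t = x k t := by
  rw [hybridState, Nat.floor_eq_on_Ico k t ht]

theorem hybridState_natCast (k : ℕ) : hybridState x k = x k k := by
  rw [hybridState, Nat.floor_natCast]

theorem natCast_add_one_le {k : ℕ} (hk : k < T) : (k : ℝ) + 1 ≤ T := by exact_mod_cast hk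

theorem exists_mem_Ico_of_mem_Icc {t : ℝ} (ht : t ∈ Icc (0 : ℝ) T) :
    (∃ k < T, t ∈ Ico (k : ℝ) (k + 1)) ∨ t = T := by
  rcases ht.2.lt_or_eq with h | h
  · exact Or.inl ⟨⌊t⌋₊, (Nat.floor_lt ht.1).2 h, Nat.floor_le ht.1, Nat.lt_floor_add_one t⟩
  · exact Or.inr h

theorem IsHybridTrajectory.isIntegralSolution (hx : IsHybridTrajectory f g x₀ u y x) {k : ℕ}
    (hk : k < T) : IsIntegralSolution (k : ℝ) (k + 1) (fun s z => f z (u s)) (x k) :=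
  ⟨hx.continuousOn k hk, hx.flow k hk⟩

theorem exists_isHybridTrajectory {K : ℝ}
    (hF : ∀ k < T, CaratheodoryField (k : ℝ) (k + 1) K (fun s z => f z (u s))) :
    ∃ x, IsHybridTrajectory f g x₀ u y x := by
  obtain ⟨x, h0, hs, hj⟩ := exists_hybrid_solution (N := T) (a := fun k => (k : ℝ))
    (b := fun k => (k : ℝ) + 1) (F := fun _ s z => f z (u s)) (fun k _ => by simp) hF
    (fun k z => if h : k < T then g z (y ⟨k, h⟩) else 0) x₀
  refine ⟨x, by simpa using h0, fun k hk => (hs k hk).1, fun k hk => (hs k hk).2, fun k => ?_⟩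
  have := hj k
  simpa using this

/-- Equal initial values give equal flows on a mode, and equal final values give equal jumps. Only
the assembled states are compared, since modes are unconstrained outside their intervals. -/
theorem IsHybridTrajectory.hybridState_eq {K : ℝ} {x' : ℕ → ℝ → Vec n}
    (hF : ∀ k < T, CaratheodoryField (k : ℝ) (k + 1) K (fun s z => f z (u s)))
    (hx : IsHybridTrajectory f g x₀ u y x) (hx' : IsHybridTrajectory f g x₀ u y x') :
    ∀ t ∈ Icc (0 : ℝ) T, hybridState x' t = hybridState x t := by
  have hflow : ∀ k < T, x' k k = x k k → ∀ t ∈ Icc (k : ℝ) (k + 1), x' k t = x k t :=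
    fun k hk h => (hx'.isIntegralSolution hk).eqOn (hx.isIntegralSolution hk) (hF k hk) h
  have hnode : ∀ k ≤ T, x' k k = x k k := by
    intro k
    induction k with
    | zero => intro _; simp [hx.init, hx'.init]
    | succ k ih =>
      intro hk
      have hk' : k < T := hk
      have h1 := hx.jump ⟨k, hk'⟩
      have h2 := hx'.jump ⟨k, hk'⟩
      simp only at h1 h2
      push_cast
      rw [h1, h2, hflow k hk' (ih hk'.le) _ (by simp)]
  intro t ht
  rcases exists_mem_Ico_of_mem_Icc ht with ⟨k, hk, hkt⟩ | rfl
  · rw [hybridState_of_mem_Ico hkt, hybridState_of_mem_Ico hkt]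
    exact hflow k hk (hnode k hk.le) t ⟨hkt.1, hkt.2.le⟩
  · rw [hybridState_natCast, hybridState_natCast]
    exact hnode T le_rfl

/-- A curve that agrees with `φ k` on the `k`-th interval is integrated piece by piece. -/
theorem intervalIntegral_eq_sum_of_eqOn {G : Type*} [NormedAddCommGroup G] [NormedSpace ℝ G]
    {φ : ℕ → ℝ → G} {Φ : ℝ → G} {a : ℕ → ℝ} {N : ℕ} (ha : ∀ k < N, a k ≤ a (k + 1))
    (h : ∀ k < N, ∀ t ∈ Ioo (a k) (a (k + 1)), φ k t = Φ t)
    (hφ : ∀ k < N, IntervalIntegrable (φ k) volume (a k) (a (k + 1))) :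
    IntervalIntegrable Φ volume (a 0) (a N) ∧
      ∫ t in a 0..a N, Φ t = ∑ k ∈ Finset.range N, ∫ t in a k..a (k + 1), φ k t := by
  have hae : ∀ k < N, φ k =ᵐ[volume.restrict (uIoc (a k) (a (k + 1)))] Φ := by
    intro k hk
    -- The right end point already belongs to the next mode; it is discarded as a null set.
    have hne : ∀ᵐ s ∂(volume.restrict (uIoc (a k) (a (k + 1)))), s ≠ a (k + 1) :=
      ae_restrict_of_ae (by simp [ae_iff])
    filter_upwards [ae_restrict_mem measurableSet_uIoc, hne] with s hs hs'
    rw [uIoc_of_le (ha k hk)] at hs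
    exact h k hk s ⟨hs.1, lt_of_le_of_ne hs.2 hs'⟩
  have hint : ∀ k < N, IntervalIntegrable Φ volume (a k) (a (k + 1)) := fun k hk =>
    (hφ k hk).congr_ae (hae k hk)
  refine ⟨IntervalIntegrable.trans_iterate hint, ?_⟩
  rw [← intervalIntegral.sum_integral_adjacent_intervals hint]
  refine Finset.sum_congr rfl fun k hk => intervalIntegral.integral_congr_ae ?_
  have := (ae_restrict_iff' measurableSet_uIoc).1 (hae k (Finset.mem_range.1 hk))
  filter_upwards [this] with s hs hs' using (hs hs').symm

end Hybrid

/-! ### Calculus of polynomial bounds. -/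

section PolyBounded

variable {ι : Type*} {M q q' : ι → ℝ}

/-- `q` is bounded by a constant times a power of `M`. -/
def PolyBounded (M q : ι → ℝ) : Prop := ∃ (C : ℝ) (N : ℕ), 0 ≤ C ∧ ∀ i, |q i| ≤ C * M i ^ N

namespace PolyBounded

theorem const (c : ℝ) : PolyBounded M (fun _ => c) := ⟨|c|, 0, abs_nonneg c, fun _ => by simp⟩

theorem self (hM : ∀ i, 1 ≤ M i) : PolyBounded M M :=
  ⟨1, 1, zero_le_one, fun i => by simp [abs_of_nonneg (zero_le_one.trans (hM i))]⟩

/-- Since `M` is at least `1`, both powers may be raised to the common exponent `N + N'`. -/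
theorem add (hM : ∀ i, 1 ≤ M i) (h : PolyBounded M q) (h' : PolyBounded M q') :
    PolyBounded M (fun i => q i + q' i) := by
  obtain ⟨C, N, hC, hN⟩ := h
  obtain ⟨C', N', hC', hN'⟩ := h'
  refine ⟨C + C', N + N', add_nonneg hC hC', fun i => (abs_add_le _ _).trans ?_⟩
  rw [add_mul]
  exact add_le_add
    ((hN i).trans (mul_le_mul_of_nonneg_left (pow_le_pow_right₀ (hM i) (by omega)) hC))
    ((hN' i).trans (mul_le_mul_of_nonneg_left (pow_le_pow_right₀ (hM i) (by omega)) hC'))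

theorem mul (h : PolyBounded M q) (h' : PolyBounded M q') :
    PolyBounded M (fun i => q i * q' i) := by
  obtain ⟨C, N, hC, hN⟩ := h
  obtain ⟨C', N', hC', hN'⟩ := h'
  refine ⟨C * C', N + N', mul_nonneg hC hC', fun i => ?_⟩
  rw [abs_mul, pow_add, mul_mul_mul_comm]
  exact mul_le_mul (hN i) (hN' i) (abs_nonneg _) ((abs_nonneg _).trans (hN i))

theorem pow (h : PolyBounded M q) (k : ℕ) : PolyBounded M (fun i => q i ^ k) := by
  induction k with
  | zero => simpa using const 1
  | succ k ih => simpa only [pow_succ] using ih.mul h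

end PolyBounded

end PolyBounded

/-! ### Growth conditions in monotone form. -/

section Growth

variable {n m p T : ℕ} {ρ : ℝ}

/-- A monotone form of the growth condition on the jump map. -/
theorem DynamicsConditions.exists_growth {f : Vec n → Vec m → Vec n} {g : Vec n → Vec p → Vec n}
    (hfg : DynamicsConditions ρ f g) : ∃ Γ : ℝ → ℝ → ℝ,
      (∀ r s, 0 ≤ r → 0 ≤ s → 0 ≤ Γ r s) ∧
      (∀ r s z y, ‖z‖ ≤ r → ‖y‖ ≤ s →
        ‖g z y‖ ≤ Γ r s ∧ ‖fderiv ℝ (fun z => g z y) z‖ ≤ Γ r s) ∧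
      ∀ {ι : Type*} (M r : ι → ℝ), (∀ i, 1 ≤ M i) → PolyBounded M r →
        PolyBounded M (fun i => Γ (r i) (M i)) := by
  obtain ⟨K₂, K₃, K₄, K₅, L₁, L₂, h2, h3, h4, h5, -, -, h⟩ := hfg.growth_g
  refine ⟨fun r s => K₂ + K₃ * r ^ L₁ + K₄ * s ^ L₂ + K₅ * r ^ L₁ * s ^ L₂,
    fun r s hr hs => by positivity, fun r s z y hz hy => ?_, fun M r hM hr => ?_⟩
  · have hle : K₂ + K₃ * ‖z‖ ^ L₁ + K₄ * ‖y‖ ^ L₂ + K₅ * ‖z‖ ^ L₁ * ‖y‖ ^ L₂ ≤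
        K₂ + K₃ * r ^ L₁ + K₄ * s ^ L₂ + K₅ * r ^ L₁ * s ^ L₂ := by
      have := (norm_nonneg z).trans hz
      gcongr
    exact ⟨(h z y).1.trans hle, (h z y).2.trans hle⟩
  · have hs := PolyBounded.self hM
    exact (((PolyBounded.const K₂).add hM ((PolyBounded.const K₃).mul (hr.pow L₁))).add hM
      ((PolyBounded.const K₄).mul (hs.pow L₂))).add hM
      (((PolyBounded.const K₅).mul (hr.pow L₁)).mul (hs.pow L₂))

/-- A monotone form of the growth condition on the costs. -/
theorem CostConditions.exists_growth {c : Vec n → Vec m → ℝ} {h : Vec n → ℝ}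
    (hch : CostConditions ρ c h) : ∃ Γ : ℝ → ℝ,
      (∀ r, 0 ≤ r → 0 ≤ Γ r) ∧
      (∀ r z w, ‖z‖ ≤ r → ‖w‖ ≤ ρ → |c z w| ≤ Γ r ∧ ‖fderiv ℝ (fun z => c z w) z‖ ≤ Γ r) ∧
      (∀ r z, ‖z‖ ≤ r → |h z| ≤ Γ r ∧ ‖fderiv ℝ h z‖ ≤ Γ r) ∧
      ∀ {ι : Type*} (M r : ι → ℝ), (∀ i, 1 ≤ M i) → PolyBounded M r →
        PolyBounded M (fun i => Γ (r i)) := by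
  obtain ⟨K₆, K₇, L₃, h6, h7, -, hc, hh⟩ := hch.growth
  have hle : ∀ r (z : Vec n), ‖z‖ ≤ r → K₆ + K₇ * ‖z‖ ^ L₃ ≤ K₆ + K₇ * r ^ L₃ := fun r z hz => by
    gcongr
  refine ⟨fun r => K₆ + K₇ * r ^ L₃, fun r hr => by positivity, fun r z w hz hw => ?_,
    fun r z hz => ?_, fun M r hM hr => ?_⟩
  · exact ⟨(hc z w hw).1.trans (hle r z hz), (hc z w hw).2.trans (hle r z hz)⟩
  · exact ⟨(hh z).1.trans (hle r z hz), (hh z).2.trans (hle r z hz)⟩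
  · exact (PolyBounded.const K₆).add hM ((PolyBounded.const K₇).mul (hr.pow L₃))

/-- The maps `g`, `c` and `h` need not be globally Lipschitz; the mean value inequality is used on a
ball known to contain both states. -/
theorem norm_image_sub_le_of_ball {E G : Type*} [NormedAddCommGroup E] [NormedSpace ℝ E]
    [NormedAddCommGroup G] [NormedSpace ℝ G] {φ : E → G} (hφ : Differentiable ℝ φ) {r C : ℝ}
    (hC : ∀ z, ‖z‖ ≤ r → ‖fderiv ℝ φ z‖ ≤ C) {z z' : E} (hz : ‖z‖ ≤ r) (hz' : ‖z'‖ ≤ r) :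
    ‖φ z - φ z'‖ ≤ C * ‖z - z'‖ :=
  Convex.norm_image_sub_le_of_norm_fderiv_le (𝕜 := ℝ) (s := Metric.closedBall 0 r)
    (fun z _ => hφ z) (fun z hz => hC z (by simpa using hz)) (convex_closedBall 0 r)
    (by simpa using hz') (by simpa using hz)

end Growth

/-! ### The needle as a set of measure ε. -/

section Needle

/-- The source of every factor ε: comparison with `C` times the indicator of the needle, whose total
integral is `ε * C` wherever the needle lies relative to `[a, b]`. -/
theorem intervalIntegral_le_of_eq_zero_off_Ioc {φ : ℝ → ℝ} {a b C τ ε : ℝ} (hab : a ≤ b)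
    (hC : 0 ≤ C) (hε : 0 ≤ ε) (hφ : IntervalIntegrable φ volume a b)
    (hle : ∀ s ∈ Icc a b, φ s ≤ C)
    (h0 : ∀ s ∈ Icc a b, s ∉ Ioc (τ - ε) τ → φ s = 0) :
    ∫ s in a..b, φ s ≤ ε * C := by
  have hi : Integrable ((Ioc (τ - ε) τ).indicator fun _ => C) (volume : Measure ℝ) :=
    (integrable_indicator_iff measurableSet_Ioc).2 (integrableOn_const (by simp))
  have hnn : ∀ s, 0 ≤ (Ioc (τ - ε) τ).indicator (fun _ => C) s := fun s =>
    indicator_nonneg (fun _ _ => hC) s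
  calc ∫ s in a..b, φ s ≤ ∫ s in a..b, (Ioc (τ - ε) τ).indicator (fun _ => C) s := by
        refine intervalIntegral.integral_mono_on hab hφ hi.intervalIntegrable fun s hs => ?_
        by_cases h : s ∈ Ioc (τ - ε) τ
        · rw [indicator_of_mem h]; exact hle s hs
        · rw [h0 s hs h]; exact hnn s
    _ ≤ ∫ s, (Ioc (τ - ε) τ).indicator (fun _ => C) s := by
        rw [intervalIntegral.integral_of_le hab]
        exact setIntegral_le_integral hi (Eventually.of_forall hnn)
    _ = ε * C := by
        rw [integral_indicator measurableSet_Ioc, setIntegral_const]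
        simp [hε]

end Needle

/-! ### Polynomial bounds on states and their displacements. -/

section Bounds

variable {n m p T : ℕ} {ρ : ℝ} {f : Vec n → Vec m → Vec n} {g : Vec n → Vec p → Vec n} {x₀ : Vec n}
  {K B : ℝ} {ι : Type*} {M : ι → ℝ} {y : ι → Fin T → Vec p}

/-- Polynomial bounds on a family of trajectories in terms of the observations. -/
theorem exists_polyBounded_state (hfg : DynamicsConditions ρ f g) (hK : 0 ≤ K)
    (hL : ∀ x' x'' : Vec n, ∀ u' u'' : Vec m, ‖u'‖ ≤ ρ → ‖u''‖ ≤ ρ →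
      ‖f x' u' - f x'' u''‖ ≤ K * (‖x' - x''‖ + ‖u' - u''‖))
    (hB0 : 0 ≤ B) (hB : ∀ w, ‖w‖ ≤ ρ → ‖f 0 w‖ ≤ B)
    (hM : ∀ i, 1 ≤ M i) (hy : ∀ i j, ‖y i j‖ ≤ M i)
    {w : ι → ℝ → Vec m} (hw : ∀ i, BoundedControl T ρ (w i)) {x : ι → ℕ → ℝ → Vec n}
    (hx : ∀ i, IsHybridTrajectory f g x₀ (w i) (y i) (x i)) :
    ∃ r : ι → ℝ, (∀ i, 0 ≤ r i) ∧ PolyBounded M r ∧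
      (∀ i, ∀ k < T, ∀ t ∈ Icc (k : ℝ) (k + 1), ‖x i k t‖ ≤ r i) ∧ ∀ i, ‖x i T T‖ ≤ r i := by
  obtain ⟨Γ, hΓ0, hΓ, hΓp⟩ := hfg.exists_growth
  have main : ∀ N ≤ T, ∃ r : ι → ℝ, (∀ i, 0 ≤ r i) ∧ PolyBounded M r ∧
      (∀ i, ∀ k < N, ∀ t ∈ Icc (k : ℝ) (k + 1), ‖x i k t‖ ≤ r i) ∧ ∀ i, ‖x i N N‖ ≤ r i := by
    intro N
    induction N with
    | zero =>
      intro _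
      refine ⟨fun _ => ‖x₀‖, fun _ => norm_nonneg _, PolyBounded.const _, fun i k hk => ?_,
        fun i => ?_⟩
      · exact absurd hk (Nat.not_lt_zero k)
      · simp [(hx i).init]
    | succ N ih =>
      intro hN
      have hN' : N < T := hN
      obtain ⟨r, hr0, hrp, hr, hrN⟩ := ih hN'.le
      -- Grönwall over one unit of time, with initial bound `r` and field at the origin bounded by
      -- `B`.
      set r₁ : ι → ℝ := fun i => (r i + B) * Real.exp K with hr₁
      have hr₁0 : ∀ i, 0 ≤ r₁ i := fun i =>
        mul_nonneg (add_nonneg (hr0 i) hB0) (Real.exp_pos _).le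
      have hr₁p : PolyBounded M r₁ := (hrp.add hM (PolyBounded.const B)).mul (PolyBounded.const _)
      have hflow : ∀ i, ∀ t ∈ Icc (N : ℝ) (N + 1), ‖x i N t‖ ≤ r₁ i := by
        intro i t ht
        have hF := (hw i).caratheodoryField hfg.contDiff_f.continuous hK hL hB
          (Nat.cast_nonneg N) (natCast_add_one_le hN')
        have h1 := ((hx i).isIntegralSolution hN').norm_le hF (B := B) (fun s hs => hB _
          ((hw i).norm_le s ⟨(Nat.cast_nonneg N).trans hs.1,
            hs.2.trans (natCast_add_one_le hN')⟩)) t ht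
        refine h1.trans (mul_le_mul ?_ (Real.exp_le_exp.2 ?_) (Real.exp_pos _).le
          (add_nonneg (hr0 i) hB0))
        · have := hrN i
          linarith
        · have : t - N ≤ 1 := by linarith [ht.2]
          nlinarith
      -- The three nonnegative summands cover the earlier modes, mode `N`, and the value after the
      -- jump.
      refine ⟨fun i => r i + r₁ i + Γ (r₁ i) (M i), fun i => ?_, ?_, fun i k hk t ht => ?_,
        fun i => ?_⟩
      · have h1 := hΓ0 (r₁ i) (M i) (hr₁0 i) (zero_le_one.trans (hM i))
        have h2 := hr0 i
        have h3 := hr₁0 i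
        positivity
      · exact (hrp.add hM hr₁p).add hM (hΓp M r₁ hM hr₁p)
      · have h1 := hΓ0 (r₁ i) (M i) (hr₁0 i) (zero_le_one.trans (hM i))
        rcases Nat.lt_succ_iff_lt_or_eq.1 hk with hk | rfl
        · linarith [hr i k hk t ht, hr₁0 i]
        · linarith [hflow i t ht, hr0 i]
      · have h1 := (hx i).jump ⟨N, hN'⟩
        simp only at h1
        push_cast
        rw [h1]
        have h2 := (hΓ (r₁ i) (M i) _ _ (hflow i (N + 1) (by simp)) (hy i ⟨N, hN'⟩)).1
        linarith [hr0 i, hr₁0 i]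
  exact main T le_rfl

/-- The effect of a needle perturbation on the state is linear in its width, with a constant that
is polynomially bounded in terms of the observations. -/
theorem exists_polyBounded_state_sub (hfg : DynamicsConditions ρ f g) (hK : 0 ≤ K)
    (hL : ∀ x' x'' : Vec n, ∀ u' u'' : Vec m, ‖u'‖ ≤ ρ → ‖u''‖ ≤ ρ →
      ‖f x' u' - f x'' u''‖ ≤ K * (‖x' - x''‖ + ‖u' - u''‖))
    (hB : ∀ w, ‖w‖ ≤ ρ → ‖f 0 w‖ ≤ B)
    (hM : ∀ i, 1 ≤ M i) (hy : ∀ i j, ‖y i j‖ ≤ M i)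
    {u : ℝ → Vec m} (hu : BoundedControl T ρ u) {v : Vec m} (hv : ‖v‖ ≤ ρ) {τ : ℝ}
    {e : ι → ℝ} (he : ∀ i, 0 ≤ e i) {x z : ι → ℕ → ℝ → Vec n}
    (hx : ∀ i, IsHybridTrajectory f g x₀ (perturbedControl u τ v (e i)) (y i) (x i))
    (hz : ∀ i, IsHybridTrajectory f g x₀ u (y i) (z i))
    {r : ι → ℝ} (hr0 : ∀ i, 0 ≤ r i) (hrp : PolyBounded M r)
    (hxr : ∀ i, ∀ k < T, ∀ t ∈ Icc (k : ℝ) (k + 1), ‖x i k t‖ ≤ r i)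
    (hzr : ∀ i, ∀ k < T, ∀ t ∈ Icc (k : ℝ) (k + 1), ‖z i k t‖ ≤ r i) :
    ∃ D : ι → ℝ, (∀ i, 0 ≤ D i) ∧ PolyBounded M D ∧
      (∀ i, ∀ k < T, ∀ t ∈ Icc (k : ℝ) (k + 1), ‖x i k t - z i k t‖ ≤ e i * D i) ∧
      ∀ i, ‖x i T T - z i T T‖ ≤ e i * D i := by
  obtain ⟨Γ, hΓ0, hΓ, hΓp⟩ := hfg.exists_growth
  have hρ : 0 ≤ ρ := (norm_nonneg v).trans hv
  have hf := hfg.contDiff_f.continuous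
  set Γ' : ι → ℝ := fun i => Γ (r i) (M i) with hΓ'
  have hΓ'0 : ∀ i, 0 ≤ Γ' i := fun i => hΓ0 _ _ (hr0 i) (zero_le_one.trans (hM i))
  have hΓ'p : PolyBounded M Γ' := hΓp M r hM hrp
  have main : ∀ N ≤ T, ∃ D : ι → ℝ, (∀ i, 0 ≤ D i) ∧ PolyBounded M D ∧
      (∀ i, ∀ k < N, ∀ t ∈ Icc (k : ℝ) (k + 1), ‖x i k t - z i k t‖ ≤ e i * D i) ∧
      ∀ i, ‖x i N N - z i N N‖ ≤ e i * D i := by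
    intro N
    induction N with
    | zero =>
      intro _
      refine ⟨fun _ => 0, fun _ => le_rfl, PolyBounded.const _, fun i k hk => ?_, fun i => ?_⟩
      · exact absurd hk (Nat.not_lt_zero k)
      · simp [(hx i).init, (hz i).init]
    | succ N ih =>
      intro hN
      have hN' : N < T := hN
      have hN1 : (N : ℝ) + 1 ≤ T := natCast_add_one_le hN'
      obtain ⟨D, hD0, hDp, hD, hDN⟩ := ih hN'.le
      -- The needle changes the control by at most `2 * ρ`, hence the field by at most `K * (2 *
      -- ρ)`, on a set of measure `e i`; Grönwall contributes the exponential.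
      set D₁ : ι → ℝ := fun i => (D i + K * (2 * ρ)) * Real.exp K with hD₁
      have hD₁0 : ∀ i, 0 ≤ D₁ i := fun i =>
        mul_nonneg (add_nonneg (hD0 i) (by positivity)) (Real.exp_pos _).le
      have hD₁p : PolyBounded M D₁ := (hDp.add hM (PolyBounded.const _)).mul (PolyBounded.const _)
      have hflow : ∀ i, ∀ t ∈ Icc (N : ℝ) (N + 1), ‖x i N t - z i N t‖ ≤ e i * D₁ i := by
        intro i t ht
        have hwi := hu.perturbed hv τ (e i)
        have hF := hwi.caratheodoryField hf hK hL hB (Nat.cast_nonneg N) hN1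
        have hG := hu.caratheodoryField hf hK hL hB (Nat.cast_nonneg N) hN1
        have hzc := (hz i).continuousOn N hN'
        have hle : (N : ℝ) ≤ N + 1 := by simp
        have hneedle : ∫ s in (N : ℝ)..(N + 1), ‖f (z i N s) (perturbedControl u τ v (e i) s) -
            f (z i N s) (u s)‖ ≤ e i * (K * (2 * ρ)) := by
          refine intervalIntegral_le_of_eq_zero_off_Ioc (τ := τ) hle (by positivity) (he i)
            ((hF.intervalIntegrable hzc (left_mem_Icc.2 hle) (right_mem_Icc.2 hle)).sub
              (hG.intervalIntegrable hzc (left_mem_Icc.2 hle) (right_mem_Icc.2 hle))).norm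
            (fun s hs => ?_) (fun s hs hs' => ?_)
          · have hs' : s ∈ Icc (0 : ℝ) T := ⟨(Nat.cast_nonneg N).trans hs.1, hs.2.trans hN1⟩
            have h1 := hL (z i N s) (z i N s) _ _ (hwi.norm_le s hs') (hu.norm_le s hs')
            rw [sub_self, norm_zero, zero_add] at h1
            refine h1.trans (mul_le_mul_of_nonneg_left ?_ hK)
            exact (norm_sub_le _ _).trans
              (by linarith [hwi.norm_le s hs', hu.norm_le s hs'])
          · have : perturbedControl u τ v (e i) s = u s := if_neg hs'
            simp [this]
        have h1 := ((hx i).isIntegralSolution hN').norm_sub_le_of_perturbation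
          ((hz i).isIntegralSolution hN') hF hG (δ := e i * (D i + K * (2 * ρ)))
          (by have := hDN i; linarith) t ht
        refine h1.trans ?_
        have h2 : e i * D₁ i = e i * (D i + K * (2 * ρ)) * Real.exp K := by
          simp only [hD₁]; ring
        rw [h2]
        refine mul_le_mul_of_nonneg_left (Real.exp_le_exp.2 ?_)
          (mul_nonneg (he i) (add_nonneg (hD0 i) (by positivity)))
        have : t - N ≤ 1 := by linarith [ht.2]
        nlinarith
      -- The last summand accounts for the jump: on the ball of radius `r i` its derivative is
      -- bounded by `Γ' i`.
      refine ⟨fun i => D i + D₁ i + Γ' i * D₁ i, fun i => ?_, ?_, fun i k hk t ht => ?_,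
        fun i => ?_⟩
      · have h1 := hΓ'0 i
        have h2 := hD0 i
        have h3 := hD₁0 i
        positivity
      · exact (hDp.add hM hD₁p).add hM (hΓ'p.mul hD₁p)
      · have h1 := mul_nonneg (he i) (mul_nonneg (hΓ'0 i) (hD₁0 i))
        have h2 := mul_nonneg (he i) (hD0 i)
        have h3 := mul_nonneg (he i) (hD₁0 i)
        rcases Nat.lt_succ_iff_lt_or_eq.1 hk with hk | rfl
        · linarith [hD i k hk t ht]
        · linarith [hflow i t ht]
      · have h1 := (hx i).jump ⟨N, hN'⟩
        have h2 := (hz i).jump ⟨N, hN'⟩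
        simp only at h1 h2
        push_cast
        rw [h1, h2]
        have hmem : (N : ℝ) + 1 ∈ Icc (N : ℝ) (N + 1) := by simp
        have h3 := norm_image_sub_le_of_ball (hfg.differentiable_g (y i ⟨N, hN'⟩))
          (fun z hz => (hΓ (r i) (M i) z _ hz (hy i ⟨N, hN'⟩)).2) (hxr i N hN' _ hmem)
          (hzr i N hN' _ hmem)
        have h4 := mul_le_mul_of_nonneg_left (hflow i _ hmem) (hΓ'0 i)
        have h5 := mul_nonneg (he i) (hD0 i)
        have h6 := mul_nonneg (he i) (hD₁0 i)
        linarith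
  exact main T le_rfl

end Bounds

/-! ### First-order effect of the needle. -/

section NeedleDerivative

variable {n m : ℕ} {Tf ρ τ C : ℝ} {u : ℝ → Vec m} {v : Vec m} {x : ℝ → ℝ → Vec n}
  {G : Type*} [NormedAddCommGroup G] [NormedSpace ℝ G] {q : Vec n → Vec m → G}

/-- The first-order effect of the needle itself on an integral along the perturbed curves. -/
theorem hasDerivWithinAt_integral_needle [CompleteSpace G] (hτ : 0 < τ) (hτT : τ ≤ Tf)
    (hu : BoundedControl Tf ρ u) (hv : ‖v‖ ≤ ρ) (huτ : ContinuousWithinAt u (Iic τ) τ)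
    (hq : Continuous fun z : Vec n × Vec m => q z.1 z.2)
    (hx : ∀ ε ∈ Icc 0 τ, ContinuousOn (x ε) (Icc 0 τ))
    (hC : ∀ ε ∈ Icc 0 τ, ∀ s ∈ Icc 0 τ, ‖x ε s - x 0 s‖ ≤ ε * C)
    (heq : ∀ ε ∈ Icc 0 τ, ∀ s ∈ Icc 0 (τ - ε), x ε s = x 0 s) :
    HasDerivWithinAt (fun ε => ∫ s in (0 : ℝ)..τ, q (x ε s) (perturbedControl u τ v ε s))
      (q (x 0 τ) v - q (x 0 τ) (u τ)) (Ici 0) 0 := by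
  have h0 : (0 : ℝ) ∈ Icc 0 τ := ⟨le_rfl, hτ.le⟩
  have hττ : τ ∈ Icc 0 τ := ⟨hτ.le, le_rfl⟩
  have hvc : BoundedControl Tf ρ (fun _ : ℝ => v) := ⟨aestronglyMeasurable_const, fun _ _ => hv⟩
  have hi0 := hu.intervalIntegrable_comp le_rfl hτ.le hτT hq (hx 0 h0)
  have hiv : ∀ ε ∈ Icc 0 τ, IntervalIntegrable (fun s => q (x ε s) v) volume 0 τ := fun ε hε =>
    hvc.intervalIntegrable_comp le_rfl hτ.le hτT hq (hx ε hε)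
  have hie : ∀ ε ∈ Icc 0 τ, IntervalIntegrable
      (fun s => q (x ε s) (perturbedControl u τ v ε s)) volume 0 τ := fun ε hε =>
    (hu.perturbed hv τ ε).intervalIntegrable_comp le_rfl hτ.le hτT hq (hx ε hε)
  have hsub : ∀ ε ∈ Icc 0 τ, τ - ε ∈ Icc 0 τ := fun ε hε =>
    ⟨by linarith [hε.2], by linarith [hε.1]⟩
  have hset : ∀ ε ∈ Icc 0 τ, uIcc (τ - ε) τ ⊆ uIcc 0 τ := fun ε hε => by
    rw [uIcc_of_le hτ.le]; exact uIcc_subset_Icc (hsub ε hε) hττ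
  have hset' : ∀ ε ∈ Icc 0 τ, uIcc 0 (τ - ε) ⊆ uIcc 0 τ := fun ε hε => by
    rw [uIcc_of_le hτ.le]; exact uIcc_subset_Icc h0 (hsub ε hε)
  have hp : ∀ ε ∈ Icc 0 τ, IntervalIntegrable (fun s => q (x ε s) v - q (x 0 s) (u s)) volume
      (τ - ε) τ := fun ε hε => ((hiv ε hε).sub hi0).mono_set (hset ε hε)
  -- The displacement bound `ε * C` is uniform in time, which upgrades left continuity of the
  -- nominal curve to a joint limit.
  have hxlim : Tendsto (fun z : ℝ × ℝ => x z.1 z.2) (𝓝[>] 0 ×ˢ 𝓝[≤] τ) (𝓝 (x 0 τ)) := by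
    have hIcc : Icc 0 τ ∈ 𝓝[≤] τ := Icc_mem_nhdsLE hτ
    have h1 : Tendsto (fun z : ℝ × ℝ => x 0 z.2) (𝓝[>] 0 ×ˢ 𝓝[≤] τ) (𝓝 (x 0 τ)) :=
      ((hx 0 h0 τ hττ).mono_of_mem_nhdsWithin hIcc).tendsto.comp tendsto_snd
    have h2 : Tendsto (fun z : ℝ × ℝ => x z.1 z.2 - x 0 z.2) (𝓝[>] 0 ×ˢ 𝓝[≤] τ) (𝓝 0) := by
      have h3 : Tendsto (fun z : ℝ × ℝ => z.1 * C) (𝓝[>] (0 : ℝ) ×ˢ 𝓝[≤] τ) (𝓝 0) := by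
        have : Tendsto (fun ε : ℝ => ε * C) (𝓝[>] 0) (𝓝 (0 * C)) :=
          ((continuous_mul_const C).tendsto 0).mono_left nhdsWithin_le_nhds
        rw [zero_mul] at this
        exact this.comp tendsto_fst
      refine squeeze_zero_norm' ?_ h3
      filter_upwards [prod_mem_prod (Icc_mem_nhdsGT_zero hτ) hIcc] with z hz
      exact hC z.1 hz.1 z.2 hz.2
    simpa using h2.add h1
  have hlim : Tendsto (fun z : ℝ × ℝ => q (x z.1 z.2) v - q (x 0 z.2) (u z.2))
      (𝓝[>] 0 ×ˢ 𝓝[≤] τ) (𝓝 (q (x 0 τ) v - q (x 0 τ) (u τ))) := by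
    have hIcc : Icc 0 τ ∈ 𝓝[≤] τ := Icc_mem_nhdsLE hτ
    have h1 : Tendsto (fun z : ℝ × ℝ => x 0 z.2) (𝓝[>] 0 ×ˢ 𝓝[≤] τ) (𝓝 (x 0 τ)) :=
      ((hx 0 h0 τ hττ).mono_of_mem_nhdsWithin hIcc).tendsto.comp tendsto_snd
    have h2 : Tendsto (fun z : ℝ × ℝ => u z.2) (𝓝[>] 0 ×ˢ 𝓝[≤] τ) (𝓝 (u τ)) :=
      huτ.tendsto.comp tendsto_snd
    exact ((hq.tendsto (x 0 τ, v)).comp (hxlim.prodMk_nhds tendsto_const_nhds)).sub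
      ((hq.tendsto (x 0 τ, u τ)).comp (h1.prodMk_nhds h2))
  have hder := hasDerivWithinAt_integral_sub_left hτ hp hlim
  -- Before `τ - ε` neither the state nor the control has changed, so the two integrals differ only
  -- over the needle.
  have hsplit : ∀ ε ∈ Icc 0 τ, ∫ s in (0 : ℝ)..τ, q (x ε s) (perturbedControl u τ v ε s) =
      (∫ s in (0 : ℝ)..τ, q (x 0 s) (u s)) +
        ∫ s in (τ - ε)..τ, (q (x ε s) v - q (x 0 s) (u s)) := by
    intro ε hε
    have hse := hsub ε hε
    rw [intervalIntegral.integral_sub ((hiv ε hε).mono_set (hset ε hε))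
      (hi0.mono_set (hset ε hε)),
      ← intervalIntegral.integral_add_adjacent_intervals ((hie ε hε).mono_set (hset' ε hε))
        ((hie ε hε).mono_set (hset ε hε)),
      ← intervalIntegral.integral_add_adjacent_intervals (hi0.mono_set (hset' ε hε))
        (hi0.mono_set (hset ε hε))]
    have e1 : ∫ s in (0 : ℝ)..(τ - ε), q (x ε s) (perturbedControl u τ v ε s) =
        ∫ s in (0 : ℝ)..(τ - ε), q (x 0 s) (u s) := by
      refine intervalIntegral.integral_congr fun s hs => ?_
      rw [uIcc_of_le hse.1] at hs
      rw [heq ε hε s hs, perturbedControl_of_le hs.2]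
    have e2 : ∫ s in (τ - ε)..τ, q (x ε s) (perturbedControl u τ v ε s) =
        ∫ s in (τ - ε)..τ, q (x ε s) v := by
      refine intervalIntegral.integral_congr_ae (Eventually.of_forall fun s hs => ?_)
      rw [uIoc_of_le hse.2] at hs
      rw [perturbedControl_of_mem hs]
    rw [e1, e2]
    abel
  refine (hder.const_add (∫ s in (0 : ℝ)..τ, q (x 0 s) (u s))).congr_of_eventuallyEq ?_
    (hsplit 0 h0)
  filter_upwards [(Icc_mem_nhdsGE hτ : Icc 0 τ ∈ 𝓝[≥] (0 : ℝ))] with ε hε using hsplit ε hε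

end NeedleDerivative

/-! ### The state variation for fixed observations. -/

section Pathwise

variable {n m p T : ℕ} {ρ : ℝ} {f : Vec n → Vec m → Vec n} {g : Vec n → Vec p → Vec n} {x₀ : Vec n}
  {K B τ C : ℝ} {y : Fin T → Vec p} {u : ℝ → Vec m} {v : Vec m} {x : ℝ → ℕ → ℝ → Vec n}

/-- Before the needle the perturbed state agrees with the nominal one. -/
theorem perturbed_state_eq_of_le (hT : 0 < T) (hf : Continuous fun z : Vec n × Vec m => f z.1 z.2)
    (hK : 0 ≤ K)
    (hL : ∀ x' x'' : Vec n, ∀ u' u'' : Vec m, ‖u'‖ ≤ ρ → ‖u''‖ ≤ ρ →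
      ‖f x' u' - f x'' u''‖ ≤ K * (‖x' - x''‖ + ‖u' - u''‖))
    (hB : ∀ w, ‖w‖ ≤ ρ → ‖f 0 w‖ ≤ B) (hu : BoundedControl T ρ u) (hv : ‖v‖ ≤ ρ)
    (hτ : τ ∈ Ioo (0 : ℝ) 1)
    (hx : ∀ ε ∈ Icc 0 τ, IsHybridTrajectory f g x₀ (perturbedControl u τ v ε) y (x ε))
    {ε : ℝ} (hε : ε ∈ Icc 0 τ) : ∀ s ∈ Icc 0 (τ - ε), x ε 0 s = x 0 0 s := by
  have h0 : (0 : ℝ) ∈ Icc 0 τ := ⟨le_rfl, hτ.1.le⟩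
  have h1T : (1 : ℝ) ≤ T := by exact_mod_cast hT
  have hsub : τ - ε ≤ 1 := by linarith [hε.1, hτ.2]
  have hres : ∀ ε' ∈ Icc 0 τ, IsIntegralSolution 0 (τ - ε)
      (fun s z => f z (perturbedControl u τ v ε' s)) (x ε' 0) := by
    intro ε' hε'
    have h := (hx ε' hε').isIntegralSolution hT
    simp only [Nat.cast_zero, zero_add] at h
    exact ⟨h.1.mono (Icc_subset_Icc_right hsub), fun t ht => h.2 t ⟨ht.1, ht.2.trans hsub⟩⟩
  have hF : ∀ ε', CaratheodoryField 0 (τ - ε) K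
      (fun s z => f z (perturbedControl u τ v ε' s)) := fun ε' =>
    (hu.perturbed hv τ ε').caratheodoryField hf hK hL hB le_rfl (hsub.trans h1T)
  intro s hs
  have hint : ∫ s in (0 : ℝ)..(τ - ε), ‖f (x 0 0 s) (perturbedControl u τ v ε s) -
      f (x 0 0 s) (perturbedControl u τ v 0 s)‖ = 0 := by
    rw [intervalIntegral.integral_congr (g := fun _ => (0 : ℝ)) fun t ht => ?_]
    · simp
    · rw [uIcc_of_le (hs.1.trans hs.2)] at ht
      simp [perturbedControl_of_le ht.2, perturbedControl_zero]
  -- The two fields coincide up to `τ - ε` and the initial values agree, so the estimate holds with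
  -- `δ = 0`.
  have := (hres ε hε).norm_sub_le_of_perturbation (hres 0 h0) (hF ε) (hF 0) (δ := 0)
    (by simp only [hint]; simp [(hx ε hε).init, (hx 0 h0).init]) s hs
  rw [zero_mul] at this
  exact sub_eq_zero.1 (norm_le_zero_iff.1 this)

theorem max_natCast_le_add_one {τ : ℝ} (hτ : τ ∈ Ioo (0 : ℝ) 1) (k : ℕ) :
    max (k : ℝ) τ ≤ k + 1 :=
  max_le (by linarith) (by have : (0 : ℝ) ≤ k := k.cast_nonneg; linarith [hτ.2])

theorem max_natCast_succ {τ : ℝ} (hτ : τ ∈ Ioo (0 : ℝ) 1) (k : ℕ) :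
    max ((k + 1 : ℕ) : ℝ) τ = k + 1 := by
  push_cast
  exact max_eq_left (by have : (0 : ℝ) ≤ k := k.cast_nonneg; linarith [hτ.2])

/-- After the needle the perturbed modes solve the unperturbed equation. -/
theorem perturbed_isIntegralSolution {ε : ℝ}
    (hF : ∀ k < T, CaratheodoryField (k : ℝ) (k + 1) K
      (fun s z => f z (perturbedControl u τ v ε s)))
    (hτ : τ ∈ Ioo (0 : ℝ) 1) {x : ℕ → ℝ → Vec n}
    (hx : IsHybridTrajectory f g x₀ (perturbedControl u τ v ε) y x) {k : ℕ} (hk : k < T) :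
    IsIntegralSolution (max (k : ℝ) τ) (k + 1) (fun s z => f z (u s)) (x k) := by
  have h := (hx.isIntegralSolution hk).mono (hF k hk)
    ⟨le_max_left (k : ℝ) τ, max_natCast_le_add_one hτ k⟩
  refine ⟨h.1, fun t ht => ?_⟩
  rw [h.2 t ht]
  congr 1
  -- The interval of integration is open on the left, which excludes the time τ, where the needle
  -- may still act.
  refine intervalIntegral.integral_congr_ae (Eventually.of_forall fun s hs => ?_)
  rw [uIoc_of_le ht.1] at hs
  simp only [perturbedControl_of_lt ((le_max_right _ _).trans_lt hs.1)]

/-- The state variation exists and solves the hybrid variational system. -/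
theorem exists_isHybridVariation (hT : 0 < T) (hfg : DynamicsConditions ρ f g) (hK : 0 ≤ K)
    (hL : ∀ x' x'' : Vec n, ∀ u' u'' : Vec m, ‖u'‖ ≤ ρ → ‖u''‖ ≤ ρ →
      ‖f x' u' - f x'' u''‖ ≤ K * (‖x' - x''‖ + ‖u' - u''‖))
    (hB : ∀ w, ‖w‖ ≤ ρ → ‖f 0 w‖ ≤ B) (hu : BoundedControl T ρ u) (hv : ‖v‖ ≤ ρ)
    (huτ : ContinuousWithinAt u (Iic τ) τ) (hτ : τ ∈ Ioo (0 : ℝ) 1)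
    (hx : ∀ ε ∈ Icc 0 τ, IsHybridTrajectory f g x₀ (perturbedControl u τ v ε) y (x ε))
    (hC : ∀ ε ∈ Icc 0 τ, ∀ k < T, ∀ t ∈ Icc (k : ℝ) (k + 1), ‖x ε k t - x 0 k t‖ ≤ ε * C) :
    ∃ ψ, IsHybridVariation f g u τ v y (x 0) ψ ∧
      (∀ k < T, ∀ t ∈ Icc (max (k : ℝ) τ) (k + 1),
        HasDerivWithinAt (fun ε => x ε k t) (ψ k t) (Ici 0) 0) ∧
      HasDerivWithinAt (fun ε => x ε T T) (ψ T T) (Ici 0) 0 := by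
  have h0 : (0 : ℝ) ∈ Icc 0 τ := ⟨le_rfl, hτ.1.le⟩
  have hττ : τ ∈ Icc 0 τ := ⟨hτ.1.le, le_rfl⟩
  have h1T : (1 : ℝ) ≤ T := by exact_mod_cast hT
  have hf := hfg.contDiff_f.continuous
  have hIcc : Icc 0 τ ∈ 𝓝[≥] (0 : ℝ) := Icc_mem_nhdsGE hτ.1
  have ha0 : ∀ k : ℕ, (0 : ℝ) ≤ max (k : ℝ) τ := fun k => k.cast_nonneg.trans (le_max_left _ _)
  have hFε : ∀ ε, ∀ k < T, CaratheodoryField (k : ℝ) (k + 1) K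
      (fun s z => f z (perturbedControl u τ v ε s)) := fun ε k hk =>
    (hu.perturbed hv τ ε).caratheodoryField hf hK hL hB k.cast_nonneg (natCast_add_one_le hk)
  have hF : ∀ k < T, CaratheodoryField (max (k : ℝ) τ) (k + 1) K (fun s z => f z (u s)) :=
    fun k hk => hu.caratheodoryField hf hK hL hB (ha0 k) (natCast_add_one_le hk)
  have hsol : ∀ ε ∈ Icc 0 τ, ∀ k < T,
      IsIntegralSolution (max (k : ℝ) τ) (k + 1) (fun s z => f z (u s)) (x ε k) :=
    fun ε hε k hk => perturbed_isIntegralSolution (hFε ε) hτ (hx ε hε) hk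
  have hA : ∀ k < T, CaratheodoryField (max (k : ℝ) τ) (k + 1) K
      (fun s z => fderiv ℝ (fun z' => f z' (u s)) (x 0 k s) z) := fun k hk =>
    hu.caratheodoryField_linearised hfg.contDiff_f hK hL (ha0 k) (natCast_add_one_le hk)
      (hsol 0 h0 k hk).1
  -- The variational system is solved first, independently of ε; its solution is then identified as
  -- the derivative, mode by mode.
  obtain ⟨ψ, hψ0, hψs, hψj⟩ := exists_hybrid_solution (N := T) (a := fun k => max (k : ℝ) τ)
    (b := fun k => (k : ℝ) + 1) (fun k _ => max_natCast_le_add_one hτ k) hA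
    (fun k z => if h : k < T then
      fderiv ℝ (fun z => g z (y ⟨k, h⟩)) (x 0 k (k + 1)) z else 0)
    (f (x 0 0 τ) v - f (x 0 0 τ) (u τ))
  have hmax0 : max ((0 : ℕ) : ℝ) τ = τ := by simpa using hτ.1.le
  have hjump : ∀ k (hk : k < T), ψ (k + 1) (k + 1) =
      fderiv ℝ (fun z => g z (y ⟨k, hk⟩)) (x 0 k (k + 1)) (ψ k (k + 1)) := by
    intro k hk
    have := hψj k
    rw [max_natCast_succ hτ, dif_pos hk] at this
    exact this
  have hvar : IsHybridVariation f g u τ v y (x 0) ψ :=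
    ⟨by rw [hmax0] at hψ0; exact hψ0, fun k hk => (hψs k hk).1, fun k hk => (hψs k hk).2,
      fun k => hjump k k.2⟩
  have hflow : ∀ k < T, HasDerivWithinAt (fun ε => x ε k (max (k : ℝ) τ)) (ψ k (max (k : ℝ) τ))
      (Ici 0) 0 → ∀ t ∈ Icc (max (k : ℝ) τ) (k + 1),
        HasDerivWithinAt (fun ε => x ε k t) (ψ k t) (Ici 0) 0 := by
    intro k hk hk0
    refine hasDerivWithinAt_flow (C := C) (x := fun ε => x ε k) (hF k hk) (hA k hk) hτ.1
      (fun ε hε => hsol ε hε k hk)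
      (fun ε hε t ht => hC ε hε k hk t ⟨(le_max_left _ _).trans ht.1, ht.2⟩) (fun s _ => ?_)
      (hψs k hk) hk0
    exact (hasFDerivAt_fst_of_contDiff hfg.contDiff_f _ _).differentiableAt.hasFDerivAt
  have hnode : ∀ k ≤ T, HasDerivWithinAt (fun ε => x ε k (max (k : ℝ) τ)) (ψ k (max (k : ℝ) τ))
      (Ici 0) 0 := by
    intro k
    induction k with
    | zero =>
      intro _
      rw [hmax0, hvar.init]
      have hcont : ∀ ε ∈ Icc 0 τ, ContinuousOn (x ε 0) (Icc 0 τ) := fun ε hε =>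
        ((hx ε hε).continuousOn 0 hT).mono (by
          simpa using Icc_subset_Icc_right hτ.2.le)
      -- The state at τ is `x₀` plus the integral of `f`, so the needle formula with integrand `f`
      -- gives the initial value of the variation.
      have hd := hasDerivWithinAt_integral_needle (x := fun ε => x ε 0) hτ.1
        (hτ.2.le.trans h1T) hu hv huτ hf hcont
        (fun ε hε s hs => hC ε hε 0 hT s (by
          simpa using ⟨hs.1, hs.2.trans hτ.2.le⟩))
        (fun ε hε => perturbed_state_eq_of_le hT hf hK hL hB hu hv hτ hx hε)
      have hval : ∀ ε ∈ Icc 0 τ, x ε 0 τ =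
          x₀ + ∫ s in (0 : ℝ)..τ, f (x ε 0 s) (perturbedControl u τ v ε s) := by
        intro ε hε
        have := (hx ε hε).flow 0 hT τ (by simpa using ⟨hτ.1.le, hτ.2.le⟩)
        rw [Nat.cast_zero, (hx ε hε).init] at this
        exact this
      refine (hd.const_add x₀).congr_of_eventuallyEq ?_ (hval 0 h0)
      filter_upwards [hIcc] with ε hε using hval ε hε
    | succ k ih =>
      intro hk
      have hk' : k < T := hk
      have h1 := hflow k hk' (ih hk'.le) (k + 1) ⟨max_natCast_le_add_one hτ k, le_rfl⟩
      rw [max_natCast_succ hτ, hjump k hk']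
      have h2 := (hfg.differentiable_g (y ⟨k, hk'⟩) (x 0 k (k + 1))).hasFDerivAt
      have h3 : HasDerivWithinAt (fun ε => g (x ε k (k + 1)) (y ⟨k, hk'⟩))
          (fderiv ℝ (fun z => g z (y ⟨k, hk'⟩)) (x 0 k (k + 1)) (ψ k (k + 1))) (Ici 0) 0 :=
        HasFDerivAt.comp_hasDerivWithinAt (l := fun z => g z (y ⟨k, hk'⟩)) (0 : ℝ) h2 h1
      refine h3.congr_of_eventuallyEq ?_
        ((hx 0 h0).jump ⟨k, hk'⟩)
      filter_upwards [hIcc] with ε hε using (hx ε hε).jump ⟨k, hk'⟩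
  refine ⟨ψ, hvar, fun k hk => hflow k hk (hnode k hk.le), ?_⟩
  have hmaxT : max (T : ℝ) τ = T := max_eq_left (hτ.2.le.trans h1T)
  simpa only [hmaxT] using hnode T le_rfl

end Pathwise

/-! ### The total cost for fixed observations. -/

section Cost

variable {n m p T : ℕ} {ρ : ℝ} {f : Vec n → Vec m → Vec n} {g : Vec n → Vec p → Vec n} {x₀ : Vec n}
  {c : Vec n → Vec m → ℝ} {h : Vec n → ℝ} {y : Fin T → Vec p} {u w : ℝ → Vec m} {v : Vec m}
  {x : ℕ → ℝ → Vec n} {K B τ C R : ℝ}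

/-- The running cost is integrable, and its integral is the sum of the integrals over the modes. -/
theorem runningCost_eq_sum (hw : BoundedControl T ρ w)
    (hc : Continuous fun z : Vec n × Vec m => c z.1 z.2)
    (hx : IsHybridTrajectory f g x₀ w y x) :
    IntervalIntegrable (fun t => c (hybridState x t) (w t)) volume 0 T ∧
      ∫ t in (0 : ℝ)..T, c (hybridState x t) (w t) =
        ∑ k ∈ Finset.range T, ∫ t in (k : ℝ)..(k + 1), c (x k t) (w t) := by
  have := intervalIntegral_eq_sum_of_eqOn (N := T) (a := fun k => (k : ℝ))
    (φ := fun k t => c (x k t) (w t)) (Φ := fun t => c (hybridState x t) (w t))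
    (fun k _ => by simp)
    (fun k hk t ht => by
      rw [hybridState_of_mem_Ico ⟨ht.1.le, by simpa using ht.2⟩])
    (fun k hk => by
      simpa using hw.intervalIntegrable_comp k.cast_nonneg (by simp) (natCast_add_one_le hk) hc
        (hx.continuousOn k hk))
  simpa using this

/-- An integral over `[τ, T]` of a function of the hybrid time, as a sum over the modes. -/
theorem intervalIntegral_from_eq_sum {φ : ℕ → ℝ → ℝ} {Φ : ℝ → ℝ} (hT : 0 < T)
    (hτ : τ ∈ Ioo (0 : ℝ) 1) (hΦ : ∀ k < T, ∀ t ∈ Ico (k : ℝ) (k + 1), Φ t = φ k t)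
    (hφ : ∀ k < T, IntervalIntegrable (φ k) volume (max (k : ℝ) τ) (k + 1)) :
    IntervalIntegrable Φ volume τ T ∧
      ∫ t in τ..T, Φ t = ∑ k ∈ Finset.range T, ∫ t in (max (k : ℝ) τ)..(k + 1), φ k t := by
  have h1T : (1 : ℝ) ≤ T := by exact_mod_cast hT
  have := intervalIntegral_eq_sum_of_eqOn (N := T) (a := fun k => max (k : ℝ) τ)
    (φ := φ) (Φ := Φ)
    (fun k _ => by rw [max_natCast_succ hτ]; exact max_natCast_le_add_one hτ k)
    (fun k hk t ht => by
      rw [max_natCast_succ hτ] at ht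
      exact (hΦ k hk t ⟨(le_max_left _ _).trans ht.1.le, ht.2⟩).symm)
    (fun k hk => by rw [max_natCast_succ hτ]; exact hφ k hk)
  simp only [max_natCast_succ hτ] at this
  rwa [show max ((0 : ℕ) : ℝ) τ = τ by simpa using hτ.1.le,
    max_eq_left (hτ.2.le.trans h1T)] at this

/-- Cutting at τ separates the two effects: only the first integral sees the needle itself, while in
the other terms ε enters through the state alone. -/
theorem totalCost_perturbed_eq (hT : 0 < T) (hτ : τ ∈ Ioo (0 : ℝ) 1) (hu : BoundedControl T ρ u)
    (hv : ‖v‖ ≤ ρ) (hc : Continuous fun z : Vec n × Vec m => c z.1 z.2) {ε : ℝ}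
    (hx : IsHybridTrajectory f g x₀ (perturbedControl u τ v ε) y x) :
    totalCost T c h (perturbedControl u τ v ε) x =
      (∫ t in (0 : ℝ)..τ, c (x 0 t) (perturbedControl u τ v ε t)) +
        (∑ k ∈ Finset.range T, ∫ t in (max (k : ℝ) τ)..(k + 1), c (x k t) (u t)) + h (x T T) := by
  have h1T : (1 : ℝ) ≤ T := by exact_mod_cast hT
  have hw := hu.perturbed hv τ ε
  have hint := (runningCost_eq_sum hw hc hx).1
  have hle : (0 : ℝ) ≤ T := zero_le_one.trans h1T
  have hmem : τ ∈ uIcc (0 : ℝ) T := by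
    rw [uIcc_of_le hle]; exact ⟨hτ.1.le, hτ.2.le.trans h1T⟩
  have hi : ∀ k < T, IntervalIntegrable (fun t => c (x k t) (perturbedControl u τ v ε t)) volume
      (max (k : ℝ) τ) (k + 1) := fun k hk =>
    hw.intervalIntegrable_comp (k.cast_nonneg.trans (le_max_left _ _))
      (max_natCast_le_add_one hτ k) (natCast_add_one_le hk) hc
      ((hx.continuousOn k hk).mono (Icc_subset_Icc_left (le_max_left _ _)))
  have htail := (intervalIntegral_from_eq_sum (φ := fun k t => c (x k t)
    (perturbedControl u τ v ε t)) (Φ := fun t => c (hybridState x t)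
    (perturbedControl u τ v ε t)) hT hτ
    (fun k hk t ht => by rw [hybridState_of_mem_Ico ht]) hi).2
  rw [totalCost, hybridState_natCast, ← intervalIntegral.integral_add_adjacent_intervals
    (hint.mono_set (uIcc_subset_uIcc_left hmem)) (hint.mono_set (uIcc_subset_uIcc_right hmem)),
    htail]
  congr 2
  · refine intervalIntegral.integral_congr fun t ht => ?_
    rw [uIcc_of_le hτ.1.le] at ht
    rw [hybridState_of_mem_Ico (k := 0) ⟨by simpa using ht.1, by simpa using ht.2.trans_lt hτ.2⟩]
  · refine Finset.sum_congr rfl fun k _ => ?_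
    refine intervalIntegral.integral_congr_ae (Eventually.of_forall fun t ht => ?_)
    rw [uIoc_of_le (max_natCast_le_add_one hτ k)] at ht
    rw [perturbedControl_of_lt ((le_max_right _ _).trans_lt ht.1)]

theorem CostConditions.abs_sub_le (hch : CostConditions ρ c h) {Γ : ℝ}
    (hΓ : ∀ z w, ‖z‖ ≤ R → ‖w‖ ≤ ρ → |c z w| ≤ Γ ∧ ‖fderiv ℝ (fun z => c z w) z‖ ≤ Γ)
    {z z' : Vec n} {w : Vec m} (hz : ‖z‖ ≤ R) (hz' : ‖z'‖ ≤ R) (hw : ‖w‖ ≤ ρ) :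
    |c z w - c z' w| ≤ Γ * ‖z - z'‖ :=
  norm_image_sub_le_of_ball ((hch.contDiff_c w).differentiable one_ne_zero)
    (fun z hz => (hΓ z w hz hw).2) hz hz'

/-- The total cost is bounded in terms of a bound on the state. -/
theorem abs_totalCost_le (hw : BoundedControl T ρ w) {Γ : ℝ}
    (hc : Continuous fun z : Vec n × Vec m => c z.1 z.2)
    (hΓ : ∀ z w, ‖z‖ ≤ R → ‖w‖ ≤ ρ → |c z w| ≤ Γ ∧ ‖fderiv ℝ (fun z => c z w) z‖ ≤ Γ)
    (hΓh : ∀ z, ‖z‖ ≤ R → |h z| ≤ Γ ∧ ‖fderiv ℝ h z‖ ≤ Γ)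
    (hx : IsHybridTrajectory f g x₀ w y x)
    (hR : ∀ k < T, ∀ t ∈ Icc (k : ℝ) (k + 1), ‖x k t‖ ≤ R) (hRT : ‖x T T‖ ≤ R) :
    |totalCost T c h w x| ≤ (T + 1) * Γ := by
  rw [totalCost, (runningCost_eq_sum hw hc hx).2, hybridState_natCast]
  have h1 : |∑ k ∈ Finset.range T, ∫ t in (k : ℝ)..(k + 1), c (x k t) (w t)| ≤ T * Γ := by
    refine (Finset.abs_sum_le_sum_abs _ _).trans ?_
    have : ∀ k ∈ Finset.range T, |∫ t in (k : ℝ)..(k + 1), c (x k t) (w t)| ≤ Γ := by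
      intro k hk
      have hk' := Finset.mem_range.1 hk
      have := intervalIntegral.norm_integral_le_of_norm_le_const (a := (k : ℝ)) (b := k + 1)
        (f := fun t => c (x k t) (w t)) (C := Γ) fun t ht => by
          rw [uIoc_of_le (by simp)] at ht
          exact (hΓ _ _ (hR k hk' t ⟨ht.1.le, ht.2⟩) (hw.norm_le t
            ⟨k.cast_nonneg.trans ht.1.le, ht.2.trans (natCast_add_one_le hk')⟩)).1
      simpa using this
    simpa using Finset.sum_le_sum this
  have h2 := (hΓh _ hRT).1
  refine (abs_add_le _ _).trans ?_
  linarith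

/-- The total cost is Lipschitz in the width of the needle. -/
theorem abs_totalCost_sub_le (hT : 0 < T) (hτ : τ ∈ Ioo (0 : ℝ) 1) (hch : CostConditions ρ c h)
    (hu : BoundedControl T ρ u) (hv : ‖v‖ ≤ ρ) {Γ D : ℝ} (hΓ0 : 0 ≤ Γ)
    (hΓ : ∀ z w, ‖z‖ ≤ R → ‖w‖ ≤ ρ → |c z w| ≤ Γ ∧ ‖fderiv ℝ (fun z => c z w) z‖ ≤ Γ)
    (hΓh : ∀ z, ‖z‖ ≤ R → |h z| ≤ Γ ∧ ‖fderiv ℝ h z‖ ≤ Γ)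
    {ε : ℝ} (hε : ε ∈ Icc 0 τ) {z : ℕ → ℝ → Vec n}
    (hx : IsHybridTrajectory f g x₀ (perturbedControl u τ v ε) y x)
    (hz : IsHybridTrajectory f g x₀ (perturbedControl u τ v 0) y z)
    (heq : ∀ s ∈ Icc 0 (τ - ε), x 0 s = z 0 s)
    (hxR : ∀ k < T, ∀ t ∈ Icc (k : ℝ) (k + 1), ‖x k t‖ ≤ R) (hxT : ‖x T T‖ ≤ R)
    (hzR : ∀ k < T, ∀ t ∈ Icc (k : ℝ) (k + 1), ‖z k t‖ ≤ R) (hzT : ‖z T T‖ ≤ R)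
    (hD : ∀ k < T, ∀ t ∈ Icc (k : ℝ) (k + 1), ‖x k t - z k t‖ ≤ ε * D)
    (hDT : ‖x T T - z T T‖ ≤ ε * D) :
    |totalCost T c h (perturbedControl u τ v ε) x - totalCost T c h (perturbedControl u τ v 0) z| ≤
      ε * (2 * Γ + (T + 1) * (Γ * D)) := by
  have hc := hch.continuous_c
  have h1T : (1 : ℝ) ≤ T := by exact_mod_cast hT
  rw [totalCost_perturbed_eq hT hτ hu hv hc hx, totalCost_perturbed_eq hT hτ hu hv hc hz]
  have hwx := hu.perturbed hv τ ε
  have hwz := hu.perturbed hv τ 0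
  have hi : ∀ {ε' : ℝ} {x : ℕ → ℝ → Vec n},
      IsHybridTrajectory f g x₀ (perturbedControl u τ v ε') y x → ∀ k < T,
        IntervalIntegrable (fun t => c (x k t) (u t)) volume (max (k : ℝ) τ) (k + 1) :=
    fun hx k hk => hu.intervalIntegrable_comp (k.cast_nonneg.trans (le_max_left _ _))
      (max_natCast_le_add_one hτ k) (natCast_add_one_le hk) hc
      ((hx.continuousOn k hk).mono (Icc_subset_Icc_left (le_max_left _ _)))
  have hi0 : ∀ {ε' : ℝ} {x : ℕ → ℝ → Vec n},
      IsHybridTrajectory f g x₀ (perturbedControl u τ v ε') y x →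
        IntervalIntegrable (fun t => c (x 0 t) (perturbedControl u τ v ε' t)) volume 0 τ :=
    fun hx => (hu.perturbed hv τ _).intervalIntegrable_comp le_rfl hτ.1.le (hτ.2.le.trans h1T) hc
      ((hx.continuousOn 0 hT).mono (by simpa using Icc_subset_Icc_right hτ.2.le))
  -- The integrands coincide before `τ - ε`, so the crude bound `2 * Γ` is needed only on the
  -- needle.
  have b1 : |(∫ t in (0 : ℝ)..τ, c (x 0 t) (perturbedControl u τ v ε t)) -
      ∫ t in (0 : ℝ)..τ, c (z 0 t) (perturbedControl u τ v 0 t)| ≤ ε * (2 * Γ) := by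
    rw [← intervalIntegral.integral_sub (hi0 hx) (hi0 hz), ← Real.norm_eq_abs]
    refine (intervalIntegral.norm_integral_le_integral_norm hτ.1.le).trans ?_
    refine intervalIntegral_le_of_eq_zero_off_Ioc (τ := τ) hτ.1.le (by positivity) hε.1
      ((hi0 hx).sub (hi0 hz)).norm (fun s hs => ?_) (fun s hs hs' => ?_)
    · have hsT : s ∈ Icc (0 : ℝ) T := ⟨hs.1, hs.2.trans (hτ.2.le.trans h1T)⟩
      have hs0 : s ∈ Icc ((0 : ℕ) : ℝ) ((0 : ℕ) + 1) := by
        simpa using ⟨hs.1, hs.2.trans hτ.2.le⟩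
      have e1 := (hΓ _ _ (hxR 0 hT s hs0) (hwx.norm_le s hsT)).1
      have e2 := (hΓ _ _ (hzR 0 hT s hs0) (hwz.norm_le s hsT)).1
      refine (norm_sub_le _ _).trans ?_
      rw [Real.norm_eq_abs, Real.norm_eq_abs]
      linarith
    · have hs1 : s ≤ τ - ε := by
        by_contra hlt
        exact hs' ⟨not_le.1 hlt, hs.2⟩
      rw [heq s ⟨hs.1, hs1⟩, perturbedControl_of_le hs1, perturbedControl_zero, sub_self,
        norm_zero]
  have b2 : |(∑ k ∈ Finset.range T, ∫ t in (max (k : ℝ) τ)..(k + 1), c (x k t) (u t)) -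
      ∑ k ∈ Finset.range T, ∫ t in (max (k : ℝ) τ)..(k + 1), c (z k t) (u t)| ≤
      T * (Γ * (ε * D)) := by
    rw [← Finset.sum_sub_distrib]
    refine (Finset.abs_sum_le_sum_abs _ _).trans ?_
    have : ∀ k ∈ Finset.range T, |(∫ t in (max (k : ℝ) τ)..(k + 1), c (x k t) (u t)) -
        ∫ t in (max (k : ℝ) τ)..(k + 1), c (z k t) (u t)| ≤ Γ * (ε * D) := by
      intro k hk
      have hk' := Finset.mem_range.1 hk
      have hle := max_natCast_le_add_one hτ k
      rw [← intervalIntegral.integral_sub (hi hx k hk') (hi hz k hk')]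
      have := intervalIntegral.norm_integral_le_of_norm_le_const (a := max (k : ℝ) τ) (b := k + 1)
        (f := fun t => c (x k t) (u t) - c (z k t) (u t)) (C := Γ * (ε * D)) fun t ht => by
          rw [uIoc_of_le hle] at ht
          have ht' : t ∈ Icc (k : ℝ) (k + 1) := ⟨(le_max_left _ _).trans ht.1.le, ht.2⟩
          exact (hch.abs_sub_le hΓ (hxR k hk' t ht') (hzR k hk' t ht') (hu.norm_le t
            ⟨k.cast_nonneg.trans ht'.1, ht'.2.trans (natCast_add_one_le hk')⟩)).trans
            (mul_le_mul_of_nonneg_left (hD k hk' t ht') hΓ0)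
      refine this.trans ?_
      have hnn : 0 ≤ Γ * (ε * D) :=
        mul_nonneg hΓ0 ((norm_nonneg _).trans hDT)
      have habs : |(k : ℝ) + 1 - max (k : ℝ) τ| ≤ 1 := by
        rw [abs_of_nonneg (by linarith)]
        linarith [le_max_left (k : ℝ) τ]
      exact mul_le_of_le_one_right hnn habs
    simpa using Finset.sum_le_sum this
  have b3 : |h (x T T) - h (z T T)| ≤ Γ * (ε * D) :=
    (norm_image_sub_le_of_ball hch.differentiable_h (fun z hz => (hΓh z hz).2) hxT hzT).trans
      (mul_le_mul_of_nonneg_left hDT hΓ0)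
  rw [add_sub_add_comm, add_sub_add_comm]
  refine (abs_add_three _ _ _).trans ?_
  linarith

/-- The first-order sensitivity of the total cost for a fixed sequence of observations. -/
theorem hasDerivWithinAt_totalCost (hT : 0 < T) (hτ : τ ∈ Ioo (0 : ℝ) 1)
    (hch : CostConditions ρ c h) (hu : BoundedControl T ρ u) (hv : ‖v‖ ≤ ρ)
    (huτ : ContinuousWithinAt u (Iic τ) τ) {Γ D : ℝ} (hΓ0 : 0 ≤ Γ)
    (hΓ : ∀ z w, ‖z‖ ≤ R → ‖w‖ ≤ ρ → |c z w| ≤ Γ ∧ ‖fderiv ℝ (fun z => c z w) z‖ ≤ Γ)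
    {x : ℝ → ℕ → ℝ → Vec n} {ψ : ℕ → ℝ → Vec n}
    (hx : ∀ ε ∈ Icc 0 τ, IsHybridTrajectory f g x₀ (perturbedControl u τ v ε) y (x ε))
    (heq : ∀ ε ∈ Icc 0 τ, ∀ s ∈ Icc 0 (τ - ε), x ε 0 s = x 0 0 s)
    (hR : ∀ ε ∈ Icc 0 τ, ∀ k < T, ∀ t ∈ Icc (k : ℝ) (k + 1), ‖x ε k t‖ ≤ R)
    (hD : ∀ ε ∈ Icc 0 τ, ∀ k < T, ∀ t ∈ Icc (k : ℝ) (k + 1), ‖x ε k t - x 0 k t‖ ≤ ε * D)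
    (hψ : ∀ k < T, ∀ t ∈ Icc (max (k : ℝ) τ) (k + 1),
      HasDerivWithinAt (fun ε => x ε k t) (ψ k t) (Ici 0) 0)
    (hψT : HasDerivWithinAt (fun ε => x ε T T) (ψ T T) (Ici 0) 0) :
    IntervalIntegrable (fun t =>
      fderiv ℝ (fun z => c z (u t)) (hybridState (x 0) t) (hybridState ψ t)) volume τ T ∧
    HasDerivWithinAt (fun ε => totalCost T c h (perturbedControl u τ v ε) (x ε))
      (c (x 0 0 τ) v - c (x 0 0 τ) (u τ) + variationCost T c h u τ (x 0) ψ) (Ici 0) 0 := by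
  have hc := hch.continuous_c
  have h1T : (1 : ℝ) ≤ T := by exact_mod_cast hT
  have h0 : (0 : ℝ) ∈ Icc 0 τ := ⟨le_rfl, hτ.1.le⟩
  have hIcc : Icc 0 τ ∈ 𝓝[≥] (0 : ℝ) := Icc_mem_nhdsGE hτ.1
  -- After τ the control is fixed, so this is the chain rule in the state under the integral sign,
  -- dominated by the constant `Γ * D`.
  have hmode : ∀ k < T, IntervalIntegrable
      (fun t => fderiv ℝ (fun z => c z (u t)) (x 0 k t) (ψ k t)) volume (max (k : ℝ) τ) (k + 1) ∧
      HasDerivWithinAt (fun ε => ∫ t in (max (k : ℝ) τ)..(k + 1), c (x ε k t) (u t))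
        (∫ t in (max (k : ℝ) τ)..(k + 1), fderiv ℝ (fun z => c z (u t)) (x 0 k t) (ψ k t))
        (Ici 0) 0 := by
    intro k hk
    refine hasDerivWithinAt_intervalIntegral_of_lipschitz_zero (C := Γ * D)
      (max_natCast_le_add_one hτ k) hτ.1 (fun ε hε => ?_) (fun ε hε t ht => ?_)
      (fun t ht => ?_)
    · exact hu.intervalIntegrable_comp (k.cast_nonneg.trans (le_max_left _ _))
        (max_natCast_le_add_one hτ k) (natCast_add_one_le hk) hc
        (((hx ε hε).continuousOn k hk).mono (Icc_subset_Icc_left (le_max_left _ _)))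
    · have ht' : t ∈ Icc (k : ℝ) (k + 1) := ⟨(le_max_left _ _).trans ht.1.le, ht.2⟩
      refine (hch.abs_sub_le hΓ (hR ε hε k hk t ht') (hR 0 h0 k hk t ht') (hu.norm_le t
        ⟨k.cast_nonneg.trans ht'.1, ht'.2.trans (natCast_add_one_le hk)⟩)).trans ?_
      have := mul_le_mul_of_nonneg_left (hD ε hε k hk t ht') hΓ0
      linarith
    · have h2 := (((hch.contDiff_c (u t)).differentiable one_ne_zero) (x 0 k t)).hasFDerivAt
      exact HasFDerivAt.comp_hasDerivWithinAt (l := fun z => c z (u t)) (0 : ℝ) h2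
        (hψ k hk t ⟨ht.1.le, ht.2⟩)
  have hneedle := hasDerivWithinAt_integral_needle (x := fun ε => x ε 0) (C := D) hτ.1
    (hτ.2.le.trans h1T) hu hv huτ hc
    (fun ε hε => ((hx ε hε).continuousOn 0 hT).mono (by
      simpa using Icc_subset_Icc_right hτ.2.le))
    (fun ε hε s hs => hD ε hε 0 hT s (by simpa using ⟨hs.1, hs.2.trans hτ.2.le⟩)) heq
  have hfinal : HasDerivWithinAt (fun ε => h (x ε T T)) (fderiv ℝ h (x 0 T T) (ψ T T))
      (Ici 0) 0 :=
    HasFDerivAt.comp_hasDerivWithinAt (l := h) (0 : ℝ) (hch.differentiable_h _).hasFDerivAt hψT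
  have hsum := HasDerivWithinAt.fun_sum (u := Finset.range T) fun k hk =>
    (hmode k (Finset.mem_range.1 hk)).2
  have hvar := intervalIntegral_from_eq_sum
    (φ := fun k t => fderiv ℝ (fun z => c z (u t)) (x 0 k t) (ψ k t))
    (Φ := fun t => fderiv ℝ (fun z => c z (u t)) (hybridState (x 0) t) (hybridState ψ t)) hT hτ
    (fun k hk t ht => by rw [hybridState_of_mem_Ico ht, hybridState_of_mem_Ico ht])
    (fun k hk => (hmode k hk).1)
  refine ⟨hvar.1, ?_⟩
  have hall := ((hneedle.add hsum).add hfinal).congr_of_eventuallyEq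
    (f₁ := fun ε => totalCost T c h (perturbedControl u τ v ε) (x ε)) (by
      filter_upwards [hIcc] with ε hε
      exact totalCost_perturbed_eq hT hτ hu hv hc (hx ε hε))
    (totalCost_perturbed_eq hT hτ hu hv hc (hx 0 h0))
  rw [variationCost, hvar.2, hybridState_natCast, hybridState_natCast, ← add_assoc]
  exact hall

end Cost

/-! ### Dependence on the outcome, and moments. -/

section Measurability

variable {n m p T : ℕ} {ρ K : ℝ} {f : Vec n → Vec m → Vec n} {g : Vec n → Vec p → Vec n}
  {x₀ : Vec n} {c : Vec n → Vec m → ℝ} {h : Vec n → ℝ} {w : ℝ → Vec m}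
  {Ω : Type*} [MeasurableSpace Ω] {P : Measure Ω} {Y : Fin T → Ω → Vec p}
  {X : Ω → ℕ → ℝ → Vec n}

/-- Solutions depend measurably on the outcome if their initial values do. -/
theorem CaratheodoryField.measurable_solution {a b : ℝ} {F : ℝ → Vec n → Vec n}
    (hF : CaratheodoryField a b K F) {x : Ω → ℝ → Vec n}
    (hx : ∀ ω, IsIntegralSolution a b F (x ω)) (h0 : Measurable fun ω => x ω a) {t : ℝ}
    (ht : t ∈ Icc a b) : Measurable fun ω => x ω t := by
  -- By uniqueness the solution at `t` is the flow map `S` applied to the initial value, and `S` is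
  -- Lipschitz in that value by Grönwall.
  choose S hS0 hS using fun z => hF.exists_isIntegralSolution (ht.1.trans ht.2) z
  have hcont : Continuous fun z => S z t := by
    refine LipschitzWith.continuous (K := Real.toNNReal (Real.exp (K * (t - a))))
      (LipschitzWith.of_dist_le_mul fun z z' => ?_)
    have := (hS z).norm_sub_le (hS z') hF t ht
    rw [hS0, hS0] at this
    rw [dist_eq_norm, dist_eq_norm, Real.coe_toNNReal _ (Real.exp_pos _).le]
    linarith
  have heq : (fun ω => x ω t) = fun ω => S (x ω a) t :=
    funext fun ω => (hx ω).eqOn (hS _) hF (hS0 _).symm ht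
  rw [heq]
  exact hcont.measurable.comp h0

/-- No measurability of `X` is assumed: it is forced by uniqueness, since each mode is a continuous
image of its initial value and each jump is continuous in the state and the observation. -/
theorem measurable_hybridTrajectory
    (hF : ∀ k < T, CaratheodoryField (k : ℝ) (k + 1) K (fun s z => f z (w s)))
    (hg : Continuous fun z : Vec n × Vec p => g z.1 z.2) (hY : ∀ i, Measurable (Y i))
    (hX : ∀ ω, IsHybridTrajectory f g x₀ w (fun i => Y i ω) (X ω)) :
    (∀ k < T, ∀ t ∈ Icc (k : ℝ) (k + 1), Measurable fun ω => X ω k t) ∧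
      Measurable fun ω => X ω T T := by
  have hflow : ∀ k < T, (Measurable fun ω => X ω k k) →
      ∀ t ∈ Icc (k : ℝ) (k + 1), Measurable fun ω => X ω k t := fun k hk h0 t ht =>
    (hF k hk).measurable_solution (fun ω => (hX ω).isIntegralSolution hk) h0 ht
  have hnode : ∀ k ≤ T, Measurable fun ω => X ω k k := by
    intro k
    induction k with
    | zero => intro _; simp [fun ω => (hX ω).init]
    | succ k ih =>
      intro hk
      have hk' : k < T := hk
      have heq : (fun ω => X ω (k + 1) ((k + 1 : ℕ) : ℝ)) =
          fun ω => g (X ω k (k + 1)) (Y ⟨k, hk'⟩ ω) := by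
        funext ω
        push_cast
        exact (hX ω).jump ⟨k, hk'⟩
      rw [heq]
      exact hg.measurable.comp ((hflow k hk' (ih hk'.le) _ (by simp)).prodMk (hY _))
  exact ⟨fun k hk => hflow k hk (hnode k hk.le), hnode T le_rfl⟩

theorem aestronglyMeasurable_totalCost (hw : BoundedControl T ρ w)
    (hF : ∀ k < T, CaratheodoryField (k : ℝ) (k + 1) K (fun s z => f z (w s)))
    (hg : Continuous fun z : Vec n × Vec p => g z.1 z.2)
    (hc : Continuous fun z : Vec n × Vec m => c z.1 z.2) (hh : Continuous h)
    (hY : ∀ i, Measurable (Y i))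
    (hX : ∀ ω, IsHybridTrajectory f g x₀ w (fun i => Y i ω) (X ω)) :
    AEStronglyMeasurable (fun ω => totalCost T c h w (X ω)) P := by
  obtain ⟨hflow, hend⟩ := measurable_hybridTrajectory hF hg hY hX
  have hmode : ∀ k < T, AEStronglyMeasurable
      (fun ω => ∫ t in (k : ℝ)..(k + 1), c (X ω k t) (w t)) P := by
    intro k hk
    have hle : (k : ℝ) ≤ k + 1 := by simp
    -- Clamping the time to the mode interval makes the curve continuous on the whole line;
    -- continuity in time and measurability in the outcome give joint measurability.
    set Z : ℝ → Ω → Vec n := fun t ω => X ω k (projIcc (k : ℝ) (k + 1) hle t) with hZ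
    have hZm : Measurable (Function.uncurry Z) :=
      measurable_uncurry_of_continuous_of_measurable
        (fun ω => (continuousOn_iff_continuous_domRestrict.1 ((hX ω).continuousOn k hk)).comp
          continuous_projIcc)
        (fun t => hflow k hk _ (projIcc (k : ℝ) (k + 1) hle t).2)
    have hwm : AEStronglyMeasurable w (volume.restrict (Ioc (k : ℝ) (k + 1))) :=
      hw.aestronglyMeasurable.mono_set (Ioc_subset_Icc_self.trans
        (Icc_subset_Icc k.cast_nonneg (natCast_add_one_le hk)))
    have hprod : AEStronglyMeasurable (fun z : Ω × ℝ => c (Z z.2 z.1) (w z.2))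
        (P.prod (volume.restrict (Ioc (k : ℝ) (k + 1)))) :=
      hc.comp_aestronglyMeasurable
        ((hZm.comp measurable_swap).aestronglyMeasurable.prodMk hwm.comp_snd)
    have heq : (fun ω => ∫ t in (k : ℝ)..(k + 1), c (X ω k t) (w t)) =
        fun ω => ∫ t in Ioc (k : ℝ) (k + 1), c (Z t ω) (w t) := by
      funext ω
      rw [intervalIntegral.integral_of_le hle]
      refine setIntegral_congr_fun measurableSet_Ioc fun t ht => ?_
      simp only [hZ]
      rw [projIcc_of_mem hle ⟨ht.1.le, ht.2⟩]
    rw [heq]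
    exact hprod.integral_prod_right'
  have heq : (fun ω => totalCost T c h w (X ω)) = fun ω =>
      (∑ k ∈ Finset.range T, ∫ t in (k : ℝ)..(k + 1), c (X ω k t) (w t)) + h (X ω T T) := by
    funext ω
    rw [totalCost, (runningCost_eq_sum hw hc (hX ω)).2, hybridState_natCast]
  rw [heq]
  exact (Finset.aestronglyMeasurable_fun_sum _ fun k hk => hmode k (Finset.mem_range.1 hk)).add
    (hh.measurable.comp hend).aestronglyMeasurable

/-- For `N > 0` the constant and every `‖Y i‖` lie in the space of N-th power integrable functions,
which is closed under sums. -/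
theorem integrable_pow_one_add_sum_norm [IsProbabilityMeasure P] (hY : ∀ i, Measurable (Y i))
    (hmom : ∀ i, ∀ k : ℕ, Integrable (fun ω => ‖Y i ω‖ ^ k) P) (N : ℕ) :
    Integrable (fun ω => (1 + ∑ i, ‖Y i ω‖) ^ N) P := by
  rcases Nat.eq_zero_or_pos N with rfl | hN
  · simp
  have hY' : ∀ i, MemLp (fun ω => ‖Y i ω‖) (N : ENNReal) P := by
    intro i
    refine (integrable_norm_rpow_iff (hY i).norm.aestronglyMeasurable (by exact_mod_cast hN.ne')
      (by simp)).1 ?_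
    simpa using hmom i N
  have hsum : MemLp (fun ω => 1 + ∑ i, ‖Y i ω‖) (N : ENNReal) P :=
    (memLp_const (1 : ℝ)).add (memLp_finsetSum _ fun i _ => hY' i)
  refine (hsum.integrable_norm_pow hN.ne').congr (Eventually.of_forall fun ω => ?_)
  have : 0 ≤ 1 + ∑ i, ‖Y i ω‖ := by positivity
  simp only [Real.norm_of_nonneg this]

end Measurability

/-! ### The mode insertion gradient. -/

theorem theorem1 {n m p T : ℕ} (hT : 0 < T) (ρ : ℝ)
    (f : Vec n → Vec m → Vec n) (g : Vec n → Vec p → Vec n)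
    (c : Vec n → Vec m → ℝ) (h : Vec n → ℝ)
    (hfg : DynamicsConditions ρ f g) (hch : CostConditions ρ c h)
    (x₀ : Vec n) (u : ℝ → Vec m) (hu : AdmissibleControl (T : ℝ) ρ u)
    {Ω : Type*} [MeasurableSpace Ω] (P : Measure Ω) [IsProbabilityMeasure P]
    (Y : Fin T → Ω → Vec p) (hYmeas : ∀ i, Measurable (Y i))
    (hYmom : ∀ i, ∀ k : ℕ, Integrable (fun ω => ‖Y i ω‖ ^ k) P)
    (τ : ℝ) (hτ : τ ∈ Ioo (0 : ℝ) 1) (v : Vec m) (hv : ‖v‖ ≤ ρ)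
    (huτ : ContinuousWithinAt u (Iic τ) τ) :
    -- every perturbed control and every observation sequence have exactly one trajectory
    (∀ ε ∈ Icc 0 τ, ∀ y : Fin T → Vec p, ∃ x,
      IsHybridTrajectory f g x₀ (perturbedControl u τ v ε) y x ∧
      ∀ x', IsHybridTrajectory f g x₀ (perturbedControl u τ v ε) y x' →
        ∀ t ∈ Icc (0 : ℝ) T, hybridState x' t = hybridState x t) ∧
    -- `X ε ω` is the perturbed trajectory for the observations `Y · ω`
    ∀ X : ℝ → Ω → ℕ → ℝ → Vec n,
      (∀ ε ∈ Icc 0 τ, ∀ ω,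
        IsHybridTrajectory f g x₀ (perturbedControl u τ v ε) (fun i => Y i ω) (X ε ω)) →
      -- the costs are integrable
      (∀ ε ∈ Icc 0 τ, ∀ ω, IntervalIntegrable
        (fun t => c (hybridState (X ε ω) t) (perturbedControl u τ v ε t)) volume 0 T) ∧
      (∀ ε ∈ Icc 0 τ,
        Integrable (fun ω => totalCost T c h (perturbedControl u τ v ε) (X ε ω)) P) ∧
      ∃ (xτ : Vec n) (Ψ : Ω → ℕ → ℝ → Vec n),
        -- the nominal state at time `τ` is deterministic
        (∀ ω, hybridState (X 0 ω) τ = xτ) ∧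
        -- `Ψ` is the state variation: the right derivative of the perturbed state at `ε = 0`
        (∀ ω, ∀ t ∈ Icc τ (T : ℝ), HasDerivWithinAt (fun ε => hybridState (X ε ω) t)
          (hybridState (Ψ ω) t) (Ici 0) 0) ∧
        -- it follows the hybrid variational system
        (∀ ω, IsHybridVariation f g u τ v (fun i => Y i ω) (X 0 ω) (Ψ ω)) ∧
        (∀ ω, IntervalIntegrable (fun t =>
          fderiv ℝ (fun z => c z (u t)) (hybridState (X 0 ω) t) (hybridState (Ψ ω) t))
          volume τ T) ∧
        Integrable (fun ω => variationCost T c h u τ (X 0 ω) (Ψ ω)) P ∧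
        -- the first-order sensitivity of the cost for each outcome
        (∀ ω, HasDerivWithinAt
          (fun ε => totalCost T c h (perturbedControl u τ v ε) (X ε ω))
          (c xτ v - c xτ (u τ) + variationCost T c h u τ (X 0 ω) (Ψ ω)) (Ici 0) 0) ∧
        -- the sensitivity of the expected cost is the expectation of this sensitivity
        HasDerivWithinAt
          (fun ε => ∫ ω, totalCost T c h (perturbedControl u τ v ε) (X ε ω) ∂P)
          (c xτ v - c xτ (u τ) + ∫ ω, variationCost T c h u τ (X 0 ω) (Ψ ω) ∂P) (Ici 0) 0 := by
  have hu' := hu.boundedControl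
  obtain ⟨K, hK1, hL⟩ := hfg.lipschitz_f
  have hK : 0 ≤ K := zero_le_one.trans hK1
  obtain ⟨B, hB0, hB⟩ := exists_bound_of_lipschitz (f := f) hv hK hL
  have hf := hfg.contDiff_f.continuous
  have hF : ∀ ε, ∀ k < T, CaratheodoryField (k : ℝ) (k + 1) K
      (fun s z => f z (perturbedControl u τ v ε s)) := fun ε k hk =>
    (hu'.perturbed hv τ ε).caratheodoryField hf hK hL hB k.cast_nonneg (natCast_add_one_le hk)
  have h0 : (0 : ℝ) ∈ Icc 0 τ := ⟨le_rfl, hτ.1.le⟩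
  refine ⟨fun ε _ y => ?_, fun X hX => ?_⟩
  · obtain ⟨x, hx⟩ := exists_isHybridTrajectory (g := g) (x₀ := x₀) (y := y) (hF ε)
    exact ⟨x, hx, fun x' hx' => hx.hybridState_eq (hF ε) hx'⟩
  have hc := hch.continuous_c
  -- Polynomial bounds, uniform over the widths of the needle.
  let M : Ω → ℝ := fun ω => 1 + ∑ j, ‖Y j ω‖
  have hM : ∀ ω, 1 ≤ M ω := fun ω => by
    have : 0 ≤ ∑ j, ‖Y j ω‖ := by positivity
    simp only [M]; linarith
  have hYM : ∀ ω j, ‖Y j ω‖ ≤ M ω := fun ω j => by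
    have := Finset.single_le_sum (f := fun j => ‖Y j ω‖) (fun _ _ => norm_nonneg _)
      (Finset.mem_univ j)
    simp only [M]; linarith
  have hMint : ∀ q : Ω → ℝ, PolyBounded M q → ∃ b : Ω → ℝ, Integrable b P ∧ ∀ ω, q ω ≤ b ω := by
    rintro q ⟨C, N, -, hq⟩
    exact ⟨fun ω => C * M ω ^ N, (integrable_pow_one_add_sum_norm hYmeas hYmom N).const_mul C,
      fun ω => (le_abs_self _).trans (hq ω)⟩
  -- The bounds are applied to the family indexed by pairs (ε, ω), with a majorant `M` that depends
  -- on ω only; the resulting constant and exponent are therefore uniform in ε.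
  have hXi : ∀ i : Icc (0 : ℝ) τ × Ω, IsHybridTrajectory f g x₀
      (perturbedControl u τ v i.1) (fun j => Y j i.2) (X i.1 i.2) := fun i => hX _ i.1.2 _
  obtain ⟨R, hR0, hRp, hR, hRT⟩ : ∃ R : Ω → ℝ, (∀ ω, 0 ≤ R ω) ∧ PolyBounded M R ∧
      (∀ ε ∈ Icc 0 τ, ∀ ω, ∀ k < T, ∀ t ∈ Icc (k : ℝ) (k + 1), ‖X ε ω k t‖ ≤ R ω) ∧
      ∀ ε ∈ Icc 0 τ, ∀ ω, ‖X ε ω T T‖ ≤ R ω := by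
    obtain ⟨r, -, ⟨C, N, hC, hrN⟩, hr, hrT⟩ := exists_polyBounded_state
      (M := fun i : Icc (0 : ℝ) τ × Ω => M i.2) hfg hK hL hB0 hB (fun i => hM i.2)
      (fun i => hYM i.2) (fun i => hu'.perturbed hv τ i.1) hXi
    refine ⟨fun ω => C * M ω ^ N, fun ω => ?_,
      (PolyBounded.const C).mul ((PolyBounded.self hM).pow N), fun ε hε ω k hk t ht => ?_,
      fun ε hε ω => ?_⟩
    · exact mul_nonneg hC (pow_nonneg (zero_le_one.trans (hM ω)) N)
    · exact (hr (⟨ε, hε⟩, ω) k hk t ht).trans ((le_abs_self _).trans (hrN (⟨ε, hε⟩, ω)))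
    · exact (hrT (⟨ε, hε⟩, ω)).trans ((le_abs_self _).trans (hrN (⟨ε, hε⟩, ω)))
  obtain ⟨D, hDp, hD, hDT⟩ : ∃ D : Ω → ℝ, PolyBounded M D ∧
      (∀ ε ∈ Icc 0 τ, ∀ ω, ∀ k < T, ∀ t ∈ Icc (k : ℝ) (k + 1),
        ‖X ε ω k t - X 0 ω k t‖ ≤ ε * D ω) ∧
      ∀ ε ∈ Icc 0 τ, ∀ ω, ‖X ε ω T T - X 0 ω T T‖ ≤ ε * D ω := by
    obtain ⟨C', N', hC', hRN⟩ := hRp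
    obtain ⟨d, -, ⟨C, N, hC, hdN⟩, hd, hdT⟩ := exists_polyBounded_state_sub
      (M := fun i : Icc (0 : ℝ) τ × Ω => M i.2) (r := fun i => R i.2) (e := fun i => i.1)
      (z := fun i => X 0 i.2) hfg hK hL hB (fun i => hM i.2)
      (fun i => hYM i.2) hu' hv (fun i => i.1.2.1) hXi
      (fun i => by simpa only [perturbedControl_zero] using hX 0 h0 i.2) (fun i => hR0 i.2)
      ⟨C', N', hC', fun i => hRN i.2⟩ (fun i => hR _ i.1.2 i.2) (fun i => hR 0 h0 i.2)
    refine ⟨fun ω => C * M ω ^ N, (PolyBounded.const C).mul ((PolyBounded.self hM).pow N),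
      fun ε hε ω k hk t ht => ?_, fun ε hε ω => ?_⟩
    · exact (hd (⟨ε, hε⟩, ω) k hk t ht).trans (mul_le_mul_of_nonneg_left
        ((le_abs_self _).trans (hdN (⟨ε, hε⟩, ω))) hε.1)
    · exact (hdT (⟨ε, hε⟩, ω)).trans (mul_le_mul_of_nonneg_left
        ((le_abs_self _).trans (hdN (⟨ε, hε⟩, ω))) hε.1)
  obtain ⟨Γ, hΓ0, hΓ, hΓh, hΓp⟩ := hch.exists_growth
  have hΓR0 : ∀ ω, 0 ≤ Γ (R ω) := fun ω => hΓ0 _ (hR0 ω)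
  have hΓRp : PolyBounded M fun ω => Γ (R ω) := hΓp M R hM hRp
  have heq : ∀ ω, ∀ ε ∈ Icc 0 τ, ∀ s ∈ Icc 0 (τ - ε), X ε ω 0 s = X 0 ω 0 s := fun ω ε hε =>
    perturbed_state_eq_of_le (x := fun ε => X ε ω) hT hf hK hL hB hu' hv hτ
      (fun ε hε => hX ε hε ω) hε
  have hcost : ∀ ε ∈ Icc 0 τ,
      Integrable (fun ω => totalCost T c h (perturbedControl u τ v ε) (X ε ω)) P := by
    intro ε hε
    obtain ⟨b, hb, hbq⟩ := hMint _ ((PolyBounded.const ((T : ℝ) + 1)).mul hΓRp)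
    refine hb.mono' (aestronglyMeasurable_totalCost (hu'.perturbed hv τ ε) (hF ε)
      hfg.continuous_g hc hch.differentiable_h.continuous hYmeas (hX ε hε))
      (Eventually.of_forall fun ω => ?_)
    exact (abs_totalCost_le (hu'.perturbed hv τ ε) hc (hΓ (R ω)) (hΓh (R ω)) (hX ε hε ω)
      (hR ε hε ω) (hRT ε hε ω)).trans (hbq ω)
  have hvar := fun ω => exists_isHybridVariation (x := fun ε => X ε ω) hT hfg hK hL hB hu' hv
    huτ hτ (fun ε hε => hX ε hε ω) (fun ε hε => hD ε hε ω)
  choose Ψ hΨ hΨd hΨT using hvar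
  have hsens := fun ω => hasDerivWithinAt_totalCost (h := h) hT hτ hch hu' hv huτ (hΓR0 ω)
    (hΓ (R ω)) (x := fun ε => X ε ω) (fun ε hε => hX ε hε ω) (heq ω) (fun ε hε => hR ε hε ω)
    (fun ε hε => hD ε hε ω) (hΨd ω) (hΨT ω)
  -- The nominal state at time `τ` does not depend on the observations.
  obtain ⟨xτ, hxτ⟩ : ∃ xτ, ∀ ω, X 0 ω 0 τ = xτ := by
    obtain ⟨ω₀⟩ : Nonempty Ω := P.nonempty_of_neZero
    refine ⟨X 0 ω₀ 0 τ, fun ω => ?_⟩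
    exact ((hX 0 h0 ω).isIntegralSolution hT).eqOn ((hX 0 h0 ω₀).isIntegralSolution hT)
      (hF 0 0 hT) (by simp [(hX 0 h0 ω).init, (hX 0 h0 ω₀).init])
      (by simpa using ⟨hτ.1.le, hτ.2.le⟩)
  simp only [hxτ] at hsens
  -- The Lipschitz constant of the cost in ε is polynomially bounded in `M`, so an integrable `b`
  -- dominates all difference quotients.
  obtain ⟨b, hb, hbq⟩ := hMint (fun ω => 2 * Γ (R ω) + (T + 1) * (Γ (R ω) * D ω))
    (((PolyBounded.const 2).mul hΓRp).add hM ((PolyBounded.const _).mul (hΓRp.mul hDp)))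
  obtain ⟨hνint, hνder⟩ := hasDerivWithinAt_integral_of_lipschitz_zero hτ.1 hcost hb
    (fun ε hε => Eventually.of_forall fun ω =>
      (abs_totalCost_sub_le hT hτ hch hu' hv (hΓR0 ω) (hΓ (R ω)) (hΓh (R ω)) hε (hX ε hε ω)
        (hX 0 h0 ω) (heq ω ε hε) (hR ε hε ω) (hRT ε hε ω) (hR 0 h0 ω) (hRT 0 h0 ω)
        (hD ε hε ω) (hDT ε hε ω)).trans (mul_le_mul_of_nonneg_left (hbq ω) hε.1))
    (Eventually.of_forall fun ω => (hsens ω).2)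
  -- Measurability and integrability of ν come from the limit of the cost quotients, so
  -- measurability of `Ψ` in the outcome is never needed; subtracting the deterministic term leaves
  -- the variation cost.
  have hVint : Integrable (fun ω => variationCost T c h u τ (X 0 ω) (Ψ ω)) P := by
    refine (hνint.sub (integrable_const (c xτ v - c xτ (u τ)))).congr
      (Eventually.of_forall fun ω => ?_)
    simp
  refine ⟨fun ε hε ω => (runningCost_eq_sum (hu'.perturbed hv τ ε) hc (hX ε hε ω)).1, hcost,
    xτ, Ψ, fun ω => ?_, fun ω t ht => ?_, hΨ, fun ω => (hsens ω).1, hVint,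
    fun ω => (hsens ω).2, ?_⟩
  · rw [hybridState_of_mem_Ico (k := 0) (by simpa using ⟨hτ.1.le, hτ.2⟩), hxτ]
  · rcases exists_mem_Ico_of_mem_Icc ⟨hτ.1.le.trans ht.1, ht.2⟩ with ⟨k, hk, hkt⟩ | rfl
    · simp only [hybridState_of_mem_Ico hkt]
      exact hΨd ω k hk t ⟨max_le hkt.1 ht.1, hkt.2.le⟩
    · simp only [hybridState_natCast]
      exact hΨT ω
  · rwa [integral_add (integrable_const _) hVint, integral_const, probReal_univ, one_smul]
      at hνder
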